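/- All groups are abelian. A group $A$ is a Whitehead group if $\mathrm{Ext}(A,\mathbb Z)=0$, and $\aleph_1$-coseparable if $\mathrm{Ext}(A,\mathbb Z^{(\omega)})=0$, where $\mathbb Z^{(\omega)}$ is the direct sum of countably many copies of $\mathbb Z$. It is $\aleph_1$-free if every countable subgroup of $A$ is free, and strongly $\aleph_1$-free if every countable subset of $A$ is contained in a free subgroup $B$ such that $A/B$ is $\aleph_1$-free. If $|A|=\aleph_1$, write $A=\bigcup_{\alpha<\omega_1}A_\alpha$ as the union of a continuous increasing chain of countable subgroups; $\Gamma(A)$ is the class of $\{\alpha<\omega_1 : A/A_\alpha \text{ is not } \aleph_1\text{-free}\}$ modulo the ideal of nonstationary subsets of $\omega_1$ (it does not depend on the chain), and $\Gamma(A)\subseteq S$ means that $\{\alpha<\omega_1 : A/A_\alpha \text{ is not } \aleph_1\text{-free}\}\setminus S$ is nonstationary. Let $\lim(\omega_1)$ be the set of nonzero limit ordinals below $\omega_1$. For $S\subseteq\lim(\omega_1)$, a ladder system on $S$ is a family $\eta=(\eta_\delta)_{\delta\in S}$ of strictly increasing functions $\eta_\delta:\omega\to\delta$ with range cofinal in $\delta$.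 For $\lambda\in\{2,\omega\}$, a $\lambda$-coloring of $\eta$ is a family $c=(c_\delta)_{\delta\in S}$ of functions $c_\delta:\omega\to\lambda$. The system $\eta$ satisfies $\lambda$-uniformization if for every $\lambda$-coloring $c$ there are $f:\omega_1\to\lambda$ and $f^*:S\to\omega$ such that $f(\eta_\delta(n))=c_\delta(n)$ for all $\delta\in S$ and all $n\ge f^*(\delta)$; it satisfies $\lambda$-uniformization on a club if for every $\lambda$-coloring $c$ there are such $f$, $f^*$ and a closed unbounded $C\subseteq\omega_1$ such that $f(\eta_\delta(n))=c_\delta(n)$ for all $\delta\in S\cap C$ and all $n\ge f^*(\delta)$. **Theorem.** Let $S$ be a stationary subset of $\omega_1$ with $S\subseteq\lim(\omega_1)$. Consider the following statements. 1. Every strongly $\aleph_1$-free group $A$ of cardinality $\aleph_1$ with $\Gamma(A)\subseteq S$ is $\aleph_1$-coseparable. 2. Every strongly $\aleph_1$-free group $A$ of cardinality $\aleph_1$ with $\Gamma(A)\subseteq S$ is a Whitehead group. 3. Every ladder system on $S$ satisfies $2$-uniformization. 4. Every ladder system on $S$ satisfies $\omega$-uniformization. 5. Every ladder system on $S$ satisfies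 $2$-uniformization on a club. 6. Every ladder system on $S$ satisfies $\omega$-uniformization on a club. Then (1) $\Rightarrow$ (2) $\Rightarrow$ (3) $\Leftrightarrow$ (4) $\Leftrightarrow$ (5) $\Leftrightarrow$ (6). -/

import Mathlib

open Cardinal Ordinal

namespace WhiteheadUniformization

/-! ### Abelian groups -/

/-- `A` is `ℵ₁`-free: every countable subgroup of `A` is free (as an abelian group). -/
def IsAlephOneFree (A : Type*) [AddCommGroup A] : Prop :=
  ∀ B : AddSubgroup A, Countable B → Module.Free ℤ B

/-- `A` is strongly `ℵ₁`-free: every countable subset of `A` is contained in a free subgroup `B`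
such that `A / B` is `ℵ₁`-free. -/
def IsStronglyAlephOneFree (A : Type*) [AddCommGroup A] : Prop :=
  ∀ X : Set A, X.Countable →
    ∃ B : AddSubgroup A, X ⊆ B ∧ Module.Free ℤ B ∧ IsAlephOneFree (A ⧸ B)

/-- `A` is a Whitehead group: `Ext¹(A, ℤ) = 0`, with Mathlib's `Ext` in the abelian category of
`ℤ`-modules. -/
def IsWhitehead (A : Type) [AddCommGroup A] : Prop :=
  Subsingleton (CategoryTheory.Abelian.Ext (ModuleCat.of ℤ A) (ModuleCat.of ℤ ℤ) 1)

/-- `A` is `ℵ₁`-coseparable: `Ext¹(A, ℤ^(ω)) = 0`, where `ℤ^(ω)` is the direct sum of countably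
many copies of `ℤ`. -/
def IsAlephOneCoseparable (A : Type) [AddCommGroup A] : Prop :=
  Subsingleton (CategoryTheory.Abelian.Ext (ModuleCat.of ℤ A) (ModuleCat.of ℤ (ℕ →₀ ℤ)) 1)

/-! ### The ordinal `ω₁` and the invariant `Γ` -/

/-- `ω₁` as the well-ordered set of countable ordinals. -/
abbrev OmegaOne : Type 1 := Set.Iio (ω₁ : Ordinal.{0})

/-- `lim(ω₁)`, the set of (nonzero) limit ordinals below `ω₁`. -/
def limOmegaOne : Set OmegaOne := {δ | Order.IsSuccLimit δ}

/-- An `ω₁`-filtration of `A`: a continuous increasing chain of countable subgroups, indexed by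
`ω₁`, whose union is `A`. -/
structure OmegaOneFiltration (A : Type*) [AddCommGroup A] where
  /-- the members of the chain -/
  toFun : OmegaOne → AddSubgroup A
  monotone : Monotone toFun
  countable : ∀ α, Countable (toFun α)
  continuous : ∀ α ∈ limOmegaOne, ∀ a ∈ toFun α, ∃ β < α, a ∈ toFun β
  exhaustive : ∀ a, ∃ α, a ∈ toFun α

/-- The set of `α < ω₁` such that `A / A_α` is not `ℵ₁`-free; equivalently, such that
`A_β / A_α` is not free for some `β > α`. -/
def OmegaOneFiltration.nonFreeSet {A : Type*} [AddCommGroup A] (F : OmegaOneFiltration A) :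
    Set OmegaOne :=
  {α | ¬ IsAlephOneFree (A ⧸ F.toFun α)}

/-- `Γ(A) ⊆ S`. For `A` of cardinality `ℵ₁`, `Γ(A)` is the class, modulo the ideal of nonstationary
subsets of `ω₁`, of `{α | A / A_α is not ℵ₁-free}`, for an `ω₁`-filtration `(A_α)` of `A`. Two
filtrations of `A` agree on a club, so the class does not depend on the filtration; it lies
below the class of `S` when `{α | A / A_α is not ℵ₁-free} \ S` is nonstationary. -/
def GammaSubset (A : Type*) [AddCommGroup A] (S : Set OmegaOne) : Prop :=
  ∃ F : OmegaOneFiltration A, ¬ IsStationary (F.nonFreeSet \ S)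

/-! ### Ladder systems and uniformization -/

/-- A ladder system on `S`: for each `δ ∈ S` a strictly increasing function from `ω` to `δ` with
range cofinal in `δ`. -/
structure LadderSystem (S : Set OmegaOne) where
  /-- the ladders -/
  ladder : S → ℕ → OmegaOne
  strictMono : ∀ δ, StrictMono (ladder δ)
  lt : ∀ δ n, ladder δ n < δ
  cofinal : ∀ δ : S, ∀ γ : OmegaOne, γ < δ → ∃ n, γ ≤ ladder δ n

/-- `η` satisfies uniformization for colorings with colors in `K`: for every coloring
`c = (c_δ : ω → K)`, `δ ∈ S`, there are `f : ω₁ → K` and `f* : S → ω` with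
`f (η_δ n) = c_δ n` for all `δ ∈ S` and all `n ≥ f* δ`. -/
def LadderSystem.Uniformization {S : Set OmegaOne} (η : LadderSystem S) (K : Type) : Prop :=
  ∀ c : S → ℕ → K, ∃ (f : OmegaOne → K) (fstar : S → ℕ),
    ∀ δ : S, ∀ n ≥ fstar δ, f (η.ladder δ n) = c δ n

/-- `η` satisfies uniformization on a club for colorings with colors in `K`: for every coloring
there are `f`, `f*` and a club `C` such that `f (η_δ n) = c_δ n` for all `δ ∈ S ∩ C` and all
`n ≥ f* δ`. -/
def LadderSystem.UniformizationOnClub {S : Set OmegaOne} (η : LadderSystem S) (K : Type) : Prop :=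
  ∀ c : S → ℕ → K, ∃ (f : OmegaOne → K) (fstar : S → ℕ) (C : Set OmegaOne), IsClub C ∧
    ∀ δ : S, (δ : OmegaOne) ∈ C → ∀ n ≥ fstar δ, f (η.ladder δ n) = c δ n

/-! ### The six hypotheses -/

/-- Every strongly `ℵ₁`-free group `A` of cardinality `ℵ₁` with `Γ(A) ⊆ S` is
`ℵ₁`-coseparable. -/
def AllCoseparable (S : Set OmegaOne) : Prop :=
  ∀ (A : Type) [AddCommGroup A], #A = ℵ₁ → IsStronglyAlephOneFree A → GammaSubset A S →
    IsAlephOneCoseparable A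

/-- Every strongly `ℵ₁`-free group `A` of cardinality `ℵ₁` with `Γ(A) ⊆ S` is Whitehead. -/
def AllWhitehead (S : Set OmegaOne) : Prop :=
  ∀ (A : Type) [AddCommGroup A], #A = ℵ₁ → IsStronglyAlephOneFree A → GammaSubset A S →
    IsWhitehead A

end WhiteheadUniformization

/-! ### Consequences of the vanishing of Ext. -/

namespace WhiteheadUniformization
open CategoryTheory

/-! (1) ⇒ (2) holds because `ℤ` is a retract of `ℤ^(ω)`.

For (2) ⇒ (3), a ladder system and integers `M ≠ 0`, `U` present a group with generators `x_γ`,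
`y_{δ,n}` (`LadderRelations`). It has cardinality `ℵ₁`, and its quotient by the stage `α` is
`ℵ₁`-free whenever `α ∉ S` (`isAlephOneFree_quotient`), so it is strongly `ℵ₁`-free with `Γ ⊆ S`. If
it is Whitehead, the relations with arbitrary inhomogeneous integers `c` are solvable in `ℤ`
(`exists_int_solution`). With pairwise coprime `M_n`, suitable `U` and `c` turn solvability into
congruences modulo `M_n` on the values `f(η_δ(n))`, in which `y_{δ,0}` is the only unknown. This is
used twice. It gives a function on `ω₁` that is injective on a tail of every ladder, hence primes
depending on the ordinal alone and distinct along each tail. Modulo these primes, two further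
solutions `f₀`, `f₁` encode the coloring in their ratio, in which the factor depending on `δ`
cancels; the color is then read off from the ordinal alone.

(3) ⇒ (5) and (4) ⇒ (3) are immediate. For (5) ⇒ (6), a natural number is coded in unary by a block
of ordinals inserted into the ladder. For (6) ⇒ (4), ordinals are projected to the club `C`. A
ladder whose projection does not converge to `δ` has a tail in one fibre, and each fibre concerns
only countably many ladders, which can be uniformized directly. The two partial solutions are glued
by a finite threshold on every fibre, itself obtained by uniformizing the projected ladders. -/

theorem IsWhitehead.of_isAlephOneCoseparable {A : Type} [AddCommGroup A]
    (h : IsAlephOneCoseparable A) : IsWhitehead A := by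
  have : Subsingleton (Abelian.Ext (ModuleCat.of ℤ A) (ModuleCat.of ℤ (ℕ →₀ ℤ)) 1) := h
  refine ⟨fun a b => ?_⟩
  let i : ModuleCat.of ℤ ℤ ⟶ ModuleCat.of ℤ (ℕ →₀ ℤ) := ModuleCat.ofHom (Finsupp.lsingle 0)
  let p : ModuleCat.of ℤ (ℕ →₀ ℤ) ⟶ ModuleCat.of ℤ ℤ := ModuleCat.ofHom (Finsupp.lapply 0)
  have hip : i ≫ p = 𝟙 _ := by
    ext
    simp [i, p]
  -- Every class factors through the trivial group with coefficients `ℤ^(ω)`.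
  have key : ∀ x : Abelian.Ext (ModuleCat.of ℤ A) (ModuleCat.of ℤ ℤ) 1,
      (x.comp (Abelian.Ext.mk₀ i) (add_zero 1)).comp (Abelian.Ext.mk₀ p) (add_zero 1) = x := by
    intro x
    rw [Abelian.Ext.comp_assoc_of_third_deg_zero, Abelian.Ext.mk₀_comp_mk₀, hip,
      Abelian.Ext.comp_mk₀_id]
  rw [← key a, ← key b, Subsingleton.elim (a.comp (Abelian.Ext.mk₀ i) (add_zero 1))]

/-- If `Ext¹(F ⧸ K, ℤ) = 0`, then homomorphisms `K → ℤ` extend to `F`. -/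
theorem IsWhitehead.exists_extension {F : Type} [AddCommGroup F] (K : Submodule ℤ F)
    (h : IsWhitehead (F ⧸ K)) (φ : K →ₗ[ℤ] ℤ) : ∃ ψ : F →ₗ[ℤ] ℤ, ∀ k : K, ψ k = φ k := by
  have hsub : Subsingleton
    (Abelian.Ext (ModuleCat.of ℤ (F ⧸ K)) (ModuleCat.of ℤ ℤ) 1) := h
  let T : ShortComplex (ModuleCat ℤ) :=
    ShortComplex.mk (ModuleCat.ofHom K.subtype) (ModuleCat.ofHom K.mkQ) (by ext; simp)
  have hT : T.ShortExact :=
    { exact := by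
        rw [ShortComplex.ShortExact.moduleCat_exact_iff_function_exact]
        exact LinearMap.exact_subtype_mkQ K
      mono_f := (ModuleCat.mono_iff_injective _).2 K.subtype_injective
      epi_g := (ModuleCat.epi_iff_surjective _).2 K.mkQ_surjective }
  have := Abelian.Ext.contravariant_sequence_exact₁ hT (ModuleCat.of ℤ ℤ)
    (Abelian.Ext.mk₀ (ModuleCat.ofHom φ)) (add_zero 1) (hsub.elim _ _)
  obtain ⟨x, hx⟩ := this
  obtain ⟨g, rfl⟩ := (Abelian.Ext.mk₀_bijective _ _).2 x
  rw [Abelian.Ext.mk₀_comp_mk₀] at hx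
  have hg := (Abelian.Ext.mk₀_bijective _ _).1 hx
  refine ⟨g.hom, fun k => ?_⟩
  have := congrArg (fun f => f.hom k) hg
  simpa [T] using this

end WhiteheadUniformization

/-! ### Submodules of free modules over a principal ideal domain. -/

namespace WhiteheadUniformization

/-- A module over a principal ideal domain that embeds in a free module is free. -/
theorem free_of_injective_finsupp {R N ι : Type*} [CommRing R] [IsDomain R]
    [IsPrincipalIdealRing R] [AddCommGroup N] [Module R N] (f : N →ₗ[R] ι →₀ R) (hf : Function.Injective f) : Module.Free R N := by
  classical
  obtain ⟨_, _⟩ := exists_wellFoundedLT ι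
  -- Elements with leading index at most `i` in a well-order of `ι`. Their `i`-th coordinates form a
  -- principal ideal; elements `b i` realizing the nonzero generators form a basis, by comparing
  -- leading terms.
  let Nle : ι → Submodule R N := fun i =>
    { carrier := {n | ∀ j, i < j → f n j = 0}
      add_mem' := fun {a b} ha hb j hj => by simp [ha j hj, hb j hj]
      zero_mem' := fun j _ => by simp
      smul_mem' := fun c n hn j hj => by simp [hn j hj] }
  let I : ι → Submodule R R := fun i => (Nle i).map (Finsupp.lapply i ∘ₗ f)
  let g : ι → R := fun i => Submodule.IsPrincipal.generator (I i)
  have hg : ∀ i, ∃ n ∈ Nle i, f n i = g i := fun i => by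
    obtain ⟨n, hn, h⟩ := (Submodule.mem_map).1 (Submodule.IsPrincipal.generator_mem (I i))
    exact ⟨n, hn, h⟩
  choose b hb hbg using hg
  have hdvd : ∀ i, ∀ n ∈ Nle i, ∃ c, f n i = c * g i := fun i n hn => by
    have : f n i ∈ I i := Submodule.mem_map.2 ⟨n, hn, rfl⟩
    obtain ⟨c, hc⟩ := (Submodule.IsPrincipal.mem_iff_eq_smul_generator (I i)).1 this
    exact ⟨c, hc⟩
  let J := {i | g i ≠ 0}
  have hli : LinearIndependent R (fun j : J => b j) := by
    rw [linearIndependent_iff]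
    intro l hl
    by_contra hne
    have hsupp : l.support.Nonempty := Finsupp.support_nonempty_iff.2 hne
    set m := l.support.max' hsupp
    have hm : m ∈ l.support := Finset.max'_mem _ _
    have h0 : f (Finsupp.linearCombination R (fun j : J => b j) l) m = 0 := by simp [hl]
    rw [Finsupp.linearCombination_apply, Finsupp.sum, map_sum, Finsupp.finsetSum_apply,
      Finset.sum_eq_single m] at h0
    · simp only [map_smul, Finsupp.smul_apply, _root_.smul_eq_mul, hbg, mul_eq_zero] at h0
      exact h0.elim (Finsupp.mem_support_iff.1 hm) m.2
    · intro j hj hjm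
      have : j < m := lt_of_le_of_ne (Finset.le_max' _ _ hj) hjm
      simp [hb j m this]
    · exact fun h => absurd hm h
  have hspan : ∀ i, ∀ n ∈ Nle i, n ∈ Submodule.span R (Set.range fun j : J => b j) := by
    intro i
    induction i using WellFoundedLT.induction with
    | ind i ih =>
    have key : ∀ n ∈ Nle i, f n i = 0 → n ∈ Submodule.span R (Set.range fun j : J => b j) := by
      intro n hn hni
      by_cases h0 : f n = 0
      · rw [hf (h0.trans (map_zero f).symm)]
        exact zero_mem _
      have hsupp : (f n).support.Nonempty := Finsupp.support_nonempty_iff.2 h0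
      have hmem := Finset.max'_mem _ hsupp
      refine ih ((f n).support.max' hsupp) ?_ n fun j hj => ?_
      · by_contra hlt
        rcases (not_lt.1 hlt).eq_or_lt with h | h
        · exact Finsupp.mem_support_iff.1 hmem (h ▸ hni)
        · exact Finsupp.mem_support_iff.1 hmem (hn _ h)
      · by_contra hne
        exact absurd (Finset.le_max' _ _ (Finsupp.mem_support_iff.2 hne)) (not_le.2 hj)
    intro n hn
    obtain ⟨c, hc⟩ := hdvd i n hn
    by_cases hgi : g i = 0
    · exact key n hn (by rw [hc, hgi, mul_zero])
    · have := key (n - c • b i) (sub_mem hn ((Nle i).smul_mem _ (hb i))) (by simp [hc, hbg])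
      rw [← sub_add_cancel n (c • b i)]
      exact add_mem this (Submodule.smul_mem _ _ (Submodule.subset_span ⟨⟨i, hgi⟩, rfl⟩))
  refine Module.Free.of_basis (Module.Basis.mk hli fun n _ => ?_)
  by_cases h0 : f n = 0
  · rw [hf (h0.trans (map_zero f).symm)]
    exact zero_mem _
  · have hsupp : (f n).support.Nonempty := Finsupp.support_nonempty_iff.2 h0
    refine hspan ((f n).support.max' hsupp) n fun j hj => ?_
    by_contra hne
    exact absurd (Finset.le_max' _ _ (Finsupp.mem_support_iff.2 hne)) (not_le.2 hj)

end WhiteheadUniformization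

/-! ### Countable ordinals. -/

namespace WhiteheadUniformization

namespace OmegaOne

theorem countable_Iio (α : OmegaOne) : (Set.Iio α).Countable := by
  have h : (Set.Iio (α : Ordinal.{0})).Countable := by
    rw [← Cardinal.le_aleph0_iff_set_countable, Cardinal.mk_Iio_ordinal]
    have : (α : Ordinal.{0}).card < ℵ₁ := by
      rw [← Cardinal.lt_ord, Cardinal.ord_aleph]
      exact α.2
    rw [← succ_aleph0, Order.lt_succ_iff] at this
    rwa [Cardinal.lift_le_aleph0]
  exact Set.Countable.preimage_of_injOn (f := Subtype.val) h (Subtype.val_injective.injOn)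

theorem countable_Iic (α : OmegaOne) : (Set.Iic α).Countable := by
  rw [← Set.Iio_insert]
  exact (countable_Iio α).insert _

theorem exists_gt_of_countable {X : Set OmegaOne} (hX : X.Countable) : ∃ β, ∀ x ∈ X, x < β := by
  have : Countable X := hX
  have h := Ordinal.iSup_lt_omega_one (f := fun x : X => Order.succ (x.1 : Ordinal.{0}))
    fun x => (isSuccLimit_omega 1).succ_lt x.1.2
  refine ⟨⟨_, h⟩, fun x hx => ?_⟩
  change (x : Ordinal) < _
  exact (Order.lt_succ _).trans_le (Ordinal.le_iSup
    (fun x : X => Order.succ (x.1 : Ordinal.{0})) ⟨x, hx⟩)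

instance : NoMaxOrder OmegaOne :=
  ⟨fun a => (exists_gt_of_countable (Set.countable_singleton a)).imp fun _ h => h a rfl⟩

instance : Nonempty OmegaOne := ⟨⟨0, omega_pos 1⟩⟩

theorem mk_eq : #OmegaOne = Cardinal.lift.{1, 0} ℵ₁ := by
  rw [Cardinal.mk_Iio_ordinal, card_omega]

end OmegaOne

theorem exists_between_of_mem_limOmegaOne {δ γ : OmegaOne} (hδ : δ ∈ limOmegaOne) (h : γ < δ) :
    ∃ γ', γ < γ' ∧ γ' < δ := by
  by_contra hne
  push Not at hne
  exact hδ.isSuccPrelimit γ ⟨h, fun c hc => not_lt.2 (hne c hc)⟩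

/-- An injection coding pairs `(α, j)` by ordinals between `α` and the next limit ordinal. -/
theorem exists_blockCode : ∃ b : OmegaOne → ℕ → OmegaOne,
    (∀ α j α' j', b α j = b α' j' → α = α' ∧ j = j') ∧ (∀ α j, α ≤ b α j) ∧
    ∀ δ ∈ limOmegaOne, ∀ α < δ, ∀ j, b α j < δ := by
  have hn : ∀ α : OmegaOne, ∃ n : ℕ, (α : Ordinal.{0}) % ω = n := fun α =>
    lt_omega0.1 (mod_lt _ omega0_ne_zero)
  choose n hn using hn
  have hα : ∀ α : OmegaOne, (α : Ordinal.{0}) = ω * (α / ω) + n α := fun α => by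
    rw [← hn, Ordinal.div_add_mod]
  have hlt : ∀ δ : Ordinal.{0}, Order.IsSuccLimit δ → ∀ α : OmegaOne, α.1 < δ → ∀ m : ℕ,
      ω * (α.1 / ω) + m < δ := by
    intro δ hδ α hαδ m
    have h0 : ω * (α.1 / ω) < δ := (Ordinal.mul_div_le _ _).trans_lt hαδ
    induction m with
    | zero => simpa using h0
    | succ m ih =>
      rw [Nat.cast_succ, ← add_assoc, ← Order.succ_eq_add_one]
      exact hδ.succ_lt ih
  -- For `α = ω·a + n` the code stays in the block of `ω·a`; it is at least `α` because `Nat.pair n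
  -- j ≥ n`.
  refine ⟨fun α j => ⟨ω * (α.1 / ω) + (Nat.pair (n α) j : ℕ),
    hlt _ (isSuccLimit_omega 1) α α.2 _⟩, ?_, ?_, ?_⟩
  · intro α j α' j' h
    have h : ω * (α.1 / ω) + (Nat.pair (n α) j : ℕ) =
      ω * (α'.1 / ω) + (Nat.pair (n α') j' : ℕ) := congrArg Subtype.val h
    have h1 := congrArg (· / ω) h
    have h2 := congrArg (· % ω) h
    simp only [mul_add_div _ omega0_ne_zero, Ordinal.div_eq_zero_of_lt (natCast_lt_omega0 _),
      add_zero, mul_add_mod_self, mod_eq_of_lt (natCast_lt_omega0 _), Nat.cast_inj] at h1 h2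
    obtain ⟨h3, h4⟩ := Nat.pair_eq_pair.1 h2
    exact ⟨Subtype.ext (by rw [hα, hα α', h1, h3]), h4⟩
  · intro α j
    change α.1 ≤ ω * (α.1 / ω) + (Nat.pair (n α) j : ℕ)
    conv_lhs => rw [hα]
    gcongr
    exact Nat.left_le_pair _ _
  · intro δ hδ α hαδ j
    change (_ : Ordinal) < δ.1
    refine hlt δ.1 ?_ α hαδ _
    refine ⟨fun h => hδ.1 fun b hb => h hb, fun a ha => ?_⟩
    have haδ : a < δ.1 := ha.1
    refine hδ.isSuccPrelimit ⟨a, haδ.trans δ.2⟩ ⟨haδ, fun c hc hcδ => ha.2 hc hcδ⟩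

end WhiteheadUniformization

/-! ### Ladders, countable families of ladders, and projection to a club. -/

namespace WhiteheadUniformization

/-- A cofinal subset of `δ` of order type `ω`. -/
structure IsLadderSet (δ : OmegaOne) (W : Set OmegaOne) : Prop where
  lt : ∀ w ∈ W, w < δ
  cofinal : ∀ γ < δ, ∃ w ∈ W, γ ≤ w
  finite : ∀ γ < δ, (W ∩ Set.Iio γ).Finite

theorem IsLadderSet.exists_strictMono {δ : OmegaOne} {W : Set OmegaOne} (hW : IsLadderSet δ W)
    (hδ : δ ∈ limOmegaOne) : ∃ e : ℕ → OmegaOne, StrictMono e ∧ Set.range e = W := by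
  classical
  have hwf : ∀ X : Set OmegaOne, X.Nonempty → ∃ m ∈ X, ∀ x ∈ X, m ≤ x := fun X hX =>
    ⟨_, wellFounded_lt.min_mem X hX, fun x hx => not_lt.1 (wellFounded_lt.not_lt_min X hx)⟩
  have hstep : ∀ w : W, ∃ w' : W, w < w' ∧ ∀ x : W, w < x → w' ≤ x := by
    rintro ⟨w, hw⟩
    obtain ⟨γ, hwγ, hγ⟩ := exists_between_of_mem_limOmegaOne hδ (hW.lt w hw)
    obtain ⟨v, hv, hγv⟩ := hW.cofinal γ hγ
    obtain ⟨m, hm, hmin⟩ := hwf {x | x ∈ W ∧ w < x} ⟨v, hv, hwγ.trans_le hγv⟩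
    exact ⟨⟨m, hm.1⟩, hm.2, fun x hx => hmin x ⟨x.2, hx⟩⟩
  choose next hlt hle using hstep
  obtain ⟨γ, hγ⟩ : ∃ γ, γ < δ := not_isMin_iff.1 hδ.1
  obtain ⟨v, hv, -⟩ := hW.cofinal γ hγ
  obtain ⟨m, hm, hmin⟩ := hwf W ⟨v, hv⟩
  let e : ℕ → W := fun n => Nat.rec ⟨m, hm⟩ (fun _ w => next w) n
  have he : StrictMono e := strictMono_nat_of_lt_succ fun n => hlt (e n)
  refine ⟨fun n => (e n).1, fun _ _ h => he h, Set.Subset.antisymm ?_ fun w hw => ?_⟩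
  · rintro _ ⟨n, rfl⟩
    exact (e n).2
  · by_contra hne
    -- A missed `w` would have infinitely many members of `W` below it.
    have hall : ∀ n, (e n).1 < w := by
      intro n
      refine lt_of_le_of_ne ?_ fun h => hne ⟨n, h⟩
      induction n with
      | zero => exact hmin w hw
      | succ n ih => exact hle (e n) ⟨w, hw⟩ (lt_of_le_of_ne ih fun h => hne ⟨n, congrArg Subtype.val h⟩)
    have hfin := (hW.finite w (hW.lt w hw)).subset
      (show Set.range (fun n => (e n).1) ⊆ _ by
        rintro _ ⟨n, rfl⟩
        exact ⟨(e n).2, hall n⟩)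
    exact Set.infinite_range_of_injective (Subtype.val_injective.comp he.injective) hfin

variable {S : Set OmegaOne}

theorem exists_ladderSystem (hS : S ⊆ limOmegaOne) (W : S → Set OmegaOne)
    (hW : ∀ δ : S, IsLadderSet δ (W δ)) :
    ∃ η : LadderSystem S, ∀ δ, Set.range (η.ladder δ) = W δ := by
  choose e he her using fun δ : S => (hW δ).exists_strictMono (hS δ.2)
  refine ⟨⟨e, he, fun δ n => (hW δ).lt _ (her δ ▸ Set.mem_range_self n), fun δ γ hγ => ?_⟩, her⟩
  obtain ⟨w, hw, h⟩ := (hW δ).cofinal γ hγ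
  rw [← her δ] at hw
  obtain ⟨n, rfl⟩ := hw
  exact ⟨n, h⟩

namespace LadderSystem

variable (η : LadderSystem S)

theorem eventually_le (δ : S) {γ : OmegaOne} (hγ : γ < δ) :
    ∀ᶠ n in Filter.atTop, γ ≤ η.ladder δ n := by
  obtain ⟨n, hn⟩ := η.cofinal δ γ hγ
  filter_upwards [Filter.eventually_ge_atTop n] with m hm
  exact hn.trans ((η.strictMono δ).monotone hm)

theorem finite_lt (δ : S) {γ : OmegaOne} (hγ : γ < δ) : {n | η.ladder δ n < γ}.Finite := by
  have := η.eventually_le δ hγ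
  rw [← Nat.cofinite_eq_atTop, Filter.eventually_cofinite] at this
  simpa using this

theorem isLadderSet_range (δ : S) : IsLadderSet δ (Set.range (η.ladder δ)) where
  lt := by
    rintro _ ⟨n, rfl⟩
    exact η.lt δ n
  cofinal γ hγ := by
    obtain ⟨n, hn⟩ := η.cofinal δ γ hγ
    exact ⟨_, ⟨n, rfl⟩, hn⟩
  finite γ hγ := by
    refine ((η.finite_lt δ hγ).image (η.ladder δ)).subset ?_
    rintro _ ⟨⟨n, rfl⟩, hn⟩
    exact ⟨n, hn, rfl⟩

/-- The ladder of the larger ordinal has only finitely many members below the smaller ordinal, so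
the two ladders share finitely many points. -/
theorem eventually_ne {δ δ' : S} (h : δ ≠ δ') :
    ∀ᶠ n in Filter.atTop, ∀ n', η.ladder δ n ≠ η.ladder δ' n' := by
  rcases lt_or_gt_of_ne h with h | h
  · have hfin := (η.finite_lt δ' (γ := δ) h).image (η.ladder δ')
    have := hfin.preimage (η.strictMono δ).injective.injOn
    rw [← Nat.cofinite_eq_atTop]
    filter_upwards [this.compl_mem_cofinite] with n hn n' heq
    exact hn ⟨n', (heq ▸ η.lt δ n : η.ladder δ' n' < δ), heq.symm⟩
  · filter_upwards [η.eventually_le δ (γ := δ') h] with n hn n' heq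
    exact (η.lt δ' n').not_ge (heq ▸ hn)

/-- Countably many ladders have pairwise disjoint tails. -/
theorem exists_disjoint_tails {D : Set S} (hD : D.Countable) (γ : OmegaOne)
    (hγ : ∀ δ ∈ D, γ < δ) :
    ∃ t : S → ℕ, (∀ δ ∈ D, ∀ n ≥ t δ, γ ≤ η.ladder δ n) ∧
      ∀ δ ∈ D, ∀ δ' ∈ D, ∀ n ≥ t δ, ∀ n' ≥ t δ', η.ladder δ n = η.ladder δ' n' → δ = δ' := by
  classical
  obtain ⟨k, hk⟩ := Set.countable_iff_exists_injOn.1 hD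
  -- In an enumeration of `D`, each ladder only has to avoid the finitely many earlier ones.
  have hev : ∀ δ ∈ D, ∃ t : ℕ, ∀ n ≥ t, γ ≤ η.ladder δ n ∧
      ∀ δ' ∈ {δ' | δ' ∈ D ∧ k δ' < k δ}, ∀ n', η.ladder δ n ≠ η.ladder δ' n' := by
    intro δ hδ
    rw [← Filter.eventually_atTop]
    refine (η.eventually_le δ (hγ δ hδ)).and ?_
    have hfin : {δ' | δ' ∈ D ∧ k δ' < k δ}.Finite :=
      Set.Finite.of_finite_image ((Set.finite_Iio (k δ)).subset (by
        rintro _ ⟨δ', h, rfl⟩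
        exact h.2)) (hk.mono fun _ h => h.1)
    rw [Filter.eventually_all_finite hfin]
    exact fun δ' hδ' => η.eventually_ne fun h => hδ'.2.ne (h ▸ rfl)
  choose! t ht using hev
  refine ⟨t, fun δ hδ n hn => (ht δ hδ n hn).1, fun δ hδ δ' hδ' n hn n' hn' heq => ?_⟩
  rcases lt_trichotomy (k δ) (k δ') with h | h | h
  · exact absurd heq.symm ((ht δ' hδ' n' hn').2 δ ⟨hδ, h⟩ n)
  · exact hk hδ hδ' h
  · exact absurd heq ((ht δ hδ n hn).2 δ' ⟨hδ', h⟩ n')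

/-- Colorings of countably many ladders can be uniformized. -/
theorem exists_uniformization_of_countable {K : Type*} [Nonempty K] {D : Set S}
    (hD : D.Countable) (c : S → ℕ → K) :
    ∃ f : OmegaOne → K, ∀ δ ∈ D, ∀ᶠ n in Filter.atTop, f (η.ladder δ n) = c δ n := by
  classical
  by_cases hlow : ∃ γ : OmegaOne, ∀ δ ∈ D, γ < δ
  · obtain ⟨γ, hγ⟩ := hlow
    obtain ⟨t, -, ht⟩ := η.exists_disjoint_tails hD γ hγ
    refine ⟨fun α => if h : ∃ p : S × ℕ, p.1 ∈ D ∧ t p.1 ≤ p.2 ∧ η.ladder p.1 p.2 = α then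
      c h.choose.1 h.choose.2 else Classical.arbitrary K, fun δ hδ => ?_⟩
    filter_upwards [Filter.eventually_ge_atTop (t δ)] with n hn
    have h : ∃ p : S × ℕ, p.1 ∈ D ∧ t p.1 ≤ p.2 ∧ η.ladder p.1 p.2 = η.ladder δ n :=
      ⟨(δ, n), hδ, hn, rfl⟩
    rw [dif_pos h]
    obtain ⟨h1, h2, h3⟩ := h.choose_spec
    generalize h.choose = p at h1 h2 h3
    obtain ⟨δ', n'⟩ := p
    obtain rfl := ht δ' h1 δ hδ n' h2 n hn h3
    rw [(η.strictMono _).injective h3]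
  · have : D = ∅ := by
      by_contra hne
      refine hlow ⟨⟨0, omega_pos 1⟩, fun δ _ => ?_⟩
      have := η.lt δ 0
      exact lt_of_le_of_lt (show (0 : Ordinal) ≤ _ from zero_le) this
    exact ⟨fun _ => Classical.arbitrary K, by simp [this]⟩

end LadderSystem

/-- The map sending `α` to the largest member of the club `C` below `α`. -/
theorem exists_club_retraction {C : Set OmegaOne} (hC : IsClub C) :
    ∃ ρ : OmegaOne → OmegaOne, (∀ α, ρ α ≤ α) ∧ (∀ β, {α | ρ α = β}.Countable) ∧
      ∀ δ ∈ limOmegaOne, (δ ∈ C ∧ ∀ γ < δ, ∃ γ' < δ, ∀ α, γ' ≤ α → γ ≤ ρ α) ∨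
        ∃ β, ∃ γ < δ, ∀ α, γ ≤ α → α < δ → ρ α = β := by
  -- Taking the least `β` with `C ∩ (β, α]` empty makes sense even if `C` has no member up to `α`.
  have hwf : ∀ α : OmegaOne, ∃ β, Disjoint C (Set.Ioc β α) ∧
      ∀ β', Disjoint C (Set.Ioc β' α) → β ≤ β' := fun α =>
    have hne : {β | Disjoint C (Set.Ioc β α)}.Nonempty := ⟨α, by simp⟩
    ⟨_, wellFounded_lt.min_mem _ hne, fun x hx => not_lt.1 (wellFounded_lt.not_lt_min _ hx)⟩
  choose ρ hρ hmin using hwf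
  have hge : ∀ α, ∀ c ∈ C, c ≤ α → c ≤ ρ α := fun α c hc hcα => not_lt.1 fun h =>
    Set.disjoint_left.1 (hρ α) hc ⟨h, hcα⟩
  refine ⟨ρ, fun α => hmin α α (by simp), fun β => ?_, fun δ hδ => ?_⟩
  · obtain ⟨β', hβ'⟩ := exists_gt β
    obtain ⟨c, hc, hβc⟩ := hC.isCofinal β'
    refine (OmegaOne.countable_Iio c).mono fun α hα => ?_
    obtain rfl : ρ α = β := hα
    exact not_le.1 fun h => (hge α c hc h).not_gt (hβ'.trans_le hβc)
  · by_cases hcof : ∀ γ < δ, ∃ c ∈ C, γ ≤ c ∧ c < δ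
    · refine Or.inl ⟨?_, fun γ hγ => ?_⟩
      · obtain ⟨γ, hγ⟩ : ∃ γ, γ < δ := not_isMin_iff.1 hδ.1
        obtain ⟨c, hc, -, hcδ⟩ := hcof γ hγ
        refine hC.isLUB_mem (t := C ∩ Set.Iio δ) Set.inter_subset_left ⟨c, hc, hcδ⟩
          ⟨fun x hx => hx.2.le, fun b hb => not_lt.1 fun hbδ => ?_⟩
        obtain ⟨b', hb', hb'δ⟩ := exists_between_of_mem_limOmegaOne hδ hbδ
        obtain ⟨c, hc, hbc, hcδ⟩ := hcof b' hb'δ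
        exact (hb ⟨hc, hcδ⟩).not_gt (hb'.trans_le hbc)
      · obtain ⟨c, hc, hγc, hcδ⟩ := hcof γ hγ
        exact ⟨c, hcδ, fun α hα => hγc.trans (hge α c hc hα)⟩
    · push Not at hcof
      obtain ⟨γ, hγ, hC'⟩ := hcof
      refine Or.inr ⟨ρ γ, γ, hγ, fun α hγα hαδ => le_antisymm ?_ ?_⟩
      · refine hmin α _ (Set.disjoint_left.2 fun c hc hc' => ?_)
        rcases le_or_gt c γ with h | h
        · exact Set.disjoint_left.1 (hρ γ) hc ⟨hc'.1, h⟩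
        · exact (hc'.2.trans_lt hαδ).not_ge (hC' c hc h.le)
      · exact hmin γ _ ((hρ α).mono_right (Set.Ioc_subset_Ioc_right hγα))

/-- Such a `δ` cannot exceed a strict upper bound of the countable fibre over `β`, since the fibre
is cofinal in `δ`. -/
theorem countable_const_on_tail {ρ : OmegaOne → OmegaOne} (hρ : ∀ β, {α | ρ α = β}.Countable)
    (β : OmegaOne) : {δ : S | ∃ γ < (δ : OmegaOne), ∀ α, γ ≤ α → α < δ → ρ α = β}.Countable := by
  obtain ⟨ν, hν⟩ := OmegaOne.exists_gt_of_countable (hρ β)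
  refine ((OmegaOne.countable_Iic ν).preimage_of_injOn Subtype.val_injective.injOn).mono ?_
  rintro δ ⟨γ, hγ, h⟩
  refine not_lt.1 fun hlt : ν < (δ : OmegaOne) => ?_
  exact (hν (max γ ν) (h _ (le_max_left _ _) (max_lt hγ hlt))).not_ge (le_max_right _ _)

end WhiteheadUniformization

/-! ### Equivalence of the forms of uniformization. -/

namespace WhiteheadUniformization

namespace LadderSystem

variable {S : Set OmegaOne} {K : Type}

theorem uniformization_iff_eventually (η : LadderSystem S) :
    η.Uniformization K ↔ ∀ c : S → ℕ → K, ∃ f : OmegaOne → K, ∀ δ : S,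
      ∀ᶠ n in Filter.atTop, f (η.ladder δ n) = c δ n := by
  refine forall_congr' fun c => exists_congr fun f => ?_
  simp only [Filter.eventually_atTop]
  exact ⟨fun ⟨N, h⟩ δ => ⟨N δ, h δ⟩, fun h => ⟨fun δ => (h δ).choose, fun δ => (h δ).choose_spec⟩⟩

theorem uniformizationOnClub_iff_eventually (η : LadderSystem S) :
    η.UniformizationOnClub K ↔ ∀ c : S → ℕ → K, ∃ (f : OmegaOne → K) (C : Set OmegaOne),
      IsClub C ∧ ∀ δ : S, (δ : OmegaOne) ∈ C →
        ∀ᶠ n in Filter.atTop, f (η.ladder δ n) = c δ n := by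
  refine forall_congr' fun c => exists_congr fun f => ?_
  simp only [Filter.eventually_atTop]
  constructor
  · rintro ⟨N, C, hC, h⟩
    exact ⟨C, hC, fun δ hδ => ⟨N δ, h δ hδ⟩⟩
  · rintro ⟨C, hC, h⟩
    choose! N hN using h
    exact ⟨N, C, hC, hN⟩

theorem Uniformization.onClub {η : LadderSystem S} (h : η.Uniformization K) :
    η.UniformizationOnClub K := fun c =>
  let ⟨f, N, hf⟩ := h c
  ⟨f, N, Set.univ, .univ, fun δ _ => hf δ⟩

theorem Uniformization.fin_two {η : LadderSystem S} (h : η.Uniformization ℕ) :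
    η.Uniformization (Fin 2) := fun c =>
  let ⟨f, N, hf⟩ := h fun δ n => c δ n
  ⟨fun α => Fin.ofNat 2 (f α), N, fun δ n hn => by simp [hf δ n hn]⟩

end LadderSystem

variable {S : Set OmegaOne}

/-- Each rung `α` is replaced by the block `b α 0, …, b α k`, where `k` is its color, and only the
last point is colored `1`. The least `j` with value `1` at `b α j` recovers `k` from `α` alone. The
new ladder system depends on the coloring. -/
theorem uniformizationOnClub_nat_of_fin_two (hS : S ⊆ limOmegaOne)
    (h : ∀ η : LadderSystem S, η.UniformizationOnClub (Fin 2)) (η : LadderSystem S) :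
    η.UniformizationOnClub ℕ := by
  classical
  rw [LadderSystem.uniformizationOnClub_iff_eventually]
  intro c
  obtain ⟨b, hinj, hle, hlt⟩ := exists_blockCode
  let W : S → Set OmegaOne := fun δ => {w | ∃ n, ∃ j ≤ c δ n, b (η.ladder δ n) j = w}
  have hW : ∀ δ : S, IsLadderSet δ (W δ) := fun δ =>
    { lt := by
        rintro _ ⟨n, j, -, rfl⟩
        exact hlt δ (hS δ.2) _ (η.lt δ n) j
      cofinal := fun γ hγ => by
        obtain ⟨n, hn⟩ := η.cofinal δ γ hγ
        exact ⟨_, ⟨n, 0, Nat.zero_le _, rfl⟩, hn.trans (hle _ _)⟩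
      finite := fun γ hγ => by
        refine ((η.finite_lt δ hγ).biUnion fun n _ =>
          (Set.finite_Iic (c δ n)).image (b (η.ladder δ n))).subset ?_
        rintro _ ⟨⟨n, j, hj, rfl⟩, hw⟩
        exact Set.mem_biUnion (x := n) ((hle _ _).trans_lt hw) ⟨j, hj, rfl⟩ }
  obtain ⟨η', hη'⟩ := exists_ladderSystem hS W hW
  obtain ⟨f, C, hC, hf⟩ := (η'.uniformizationOnClub_iff_eventually).1 (h η')
    fun δ m => if ∃ n, η'.ladder δ m = b (η.ladder δ n) (c δ n) then 1 else 0
  refine ⟨fun α => sInf {j | f (b α j) = 1}, C, hC, fun δ hδ => ?_⟩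
  obtain ⟨N, hN⟩ := Filter.eventually_atTop.1 (hf δ hδ)
  filter_upwards [η.eventually_le δ (η'.lt δ N)] with n hn
  have key : ∀ j ≤ c δ n, (f (b (η.ladder δ n) j) = 1 ↔ j = c δ n) := by
    intro j hj
    obtain ⟨m, hm⟩ : b (η.ladder δ n) j ∈ Set.range (η'.ladder δ) := by
      rw [hη']
      exact ⟨n, j, hj, rfl⟩
    have hNm : N ≤ m := (η'.strictMono δ).le_iff_le.1 (hm ▸ hn.trans (hle _ _))
    rw [← hm, hN m hNm, hm]
    constructor
    · intro h1
      by_contra hne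
      rw [if_neg] at h1
      · exact absurd h1 (by decide)
      · rintro ⟨n', hn'⟩
        obtain ⟨h2, h3⟩ := hinj _ _ _ _ hn'
        rw [(η.strictMono δ).injective h2] at hne
        exact hne h3
    · rintro rfl
      exact if_pos ⟨n, rfl⟩
  refine le_antisymm (Nat.sInf_le ((key _ le_rfl).2 rfl)) ?_
  have hmem : sInf {j | f (b (η.ladder δ n) j) = 1} ∈ {j | f (b (η.ladder δ n) j) = 1} :=
    Nat.sInf_mem ⟨_, (key _ le_rfl).2 rfl⟩
  by_contra hlt
  exact hlt ((key _ (not_le.1 hlt).le).1 hmem).ge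

/-- Uniformization on a club lets one bound numbers attached to the ladders on all of `S`. -/
theorem exists_bound_of_uniformizationOnClub (hS : S ⊆ limOmegaOne)
    {η : LadderSystem S} (h : η.UniformizationOnClub ℕ) (g : S → ℕ → ℕ) :
    ∃ q : OmegaOne → ℕ, ∀ δ : S, ∀ᶠ n in Filter.atTop, g δ n ≤ q (η.ladder δ n) := by
  obtain ⟨f, C, hC, hf⟩ := (η.uniformizationOnClub_iff_eventually).1 h g
  obtain ⟨ρ, -, hρc, hρ⟩ := exists_club_retraction hC
  choose F hF using fun β => η.exists_uniformization_of_countable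
    (countable_const_on_tail (S := S) hρc β) g
  -- As only an upper bound is wanted, the maximum avoids deciding which of the two solutions
  -- applies at `α`.
  refine ⟨fun α => max (f α) (F (ρ α) α), fun δ => ?_⟩
  rcases hρ δ (hS δ.2) with ⟨hδ, -⟩ | ⟨β, γ, hγ, hconst⟩
  · filter_upwards [hf δ hδ] with n hn
    exact hn ▸ le_max_left _ _
  · filter_upwards [hF β δ ⟨γ, hγ, hconst⟩, η.eventually_le δ hγ] with n hn hle
    rw [hconst _ hle (η.lt δ n), hn]
    exact le_max_right _ _

/-- An ordinal may lie on ladders served by `f` and on ladders served by `F`. In the fibre over `β`,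
the finitely many `α` with `N α ≤ q β` are given to `f`, the rest to `F β`. A ladder with a tail in
one fibre loses only finitely many points; `q` is chosen so that almost all points of the other
ladders go to `f`. -/
theorem uniformization_of_uniformizationOnClub (hS : S ⊆ limOmegaOne)
    (h : ∀ η : LadderSystem S, η.UniformizationOnClub ℕ) (η : LadderSystem S) :
    η.Uniformization ℕ := by
  classical
  rw [LadderSystem.uniformization_iff_eventually]
  intro c
  obtain ⟨f, C, hC, hf⟩ := (η.uniformizationOnClub_iff_eventually).1 (h η) c
  obtain ⟨ρ, hρle, hρc, hρ⟩ := exists_club_retraction hC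
  choose F hF using fun β => η.exists_uniformization_of_countable
    (countable_const_on_tail (S := S) hρc β) c
  have hN : ∃ N : OmegaOne → ℕ, ∀ β, Set.InjOn N {α | ρ α = β} := by
    choose e he using fun β => Set.countable_iff_exists_injOn.1 (hρc β)
    refine ⟨fun α => e (ρ α) α, fun β a ha a' ha' heq => ?_⟩
    simp only [Set.mem_ofPred_eq] at ha ha'
    simp only [ha, ha'] at heq
    exact he β ha ha' heq
  obtain ⟨N, hN⟩ := hN
  let T : S → Prop := fun δ => ∀ γ < (δ : OmegaOne), ∃ γ' < (δ : OmegaOne), ∀ α, γ' ≤ α → γ ≤ ρ α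
  let W : S → Set OmegaOne := fun δ =>
    if T δ then Set.range fun n => ρ (η.ladder δ n) else Set.range (η.ladder δ)
  have hfin : ∀ δ, T δ → ∀ γ < (δ : OmegaOne), {n | ρ (η.ladder δ n) < γ}.Finite := by
    intro δ hT γ hγ
    obtain ⟨γ', hγ', hle⟩ := hT γ hγ
    exact (η.finite_lt δ hγ').subset fun n hn => not_le.1 fun h => (hle _ h).not_gt hn
  have hW : ∀ δ : S, IsLadderSet δ (W δ) := by
    intro δ
    by_cases hT : T δ
    · simp only [W, if_pos hT]
      exact
        { lt := by
            rintro _ ⟨n, rfl⟩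
            exact (hρle _).trans_lt (η.lt δ n)
          cofinal := fun γ hγ => by
            obtain ⟨γ', hγ', hle⟩ := hT γ hγ
            obtain ⟨n, hn⟩ := η.cofinal δ γ' hγ'
            exact ⟨_, ⟨n, rfl⟩, hle _ hn⟩
          finite := fun γ hγ => by
            refine ((hfin δ hT γ hγ).image fun n => ρ (η.ladder δ n)).subset ?_
            rintro _ ⟨⟨n, rfl⟩, hn⟩
            exact ⟨n, hn, rfl⟩ }
    · simp only [W, if_neg hT]
      exact η.isLadderSet_range δ
  obtain ⟨η', hη'⟩ := exists_ladderSystem hS W hW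
  have hfib : ∀ δ, T δ → ∀ m, {n | ρ (η.ladder δ n) = η'.ladder δ m}.Finite := by
    intro δ hT m
    refine (hfin δ hT _ (η'.lt δ (m + 1))).subset fun n hn => ?_
    simp only [Set.mem_ofPred_eq] at hn ⊢
    exact hn ▸ η'.strictMono δ m.lt_succ_self
  -- A ladder satisfying `T` meets each fibre in a finite set; `q` must eventually bound `N` on
  -- these sets, along the projected ladder `η'`.
  obtain ⟨q, hq⟩ := exists_bound_of_uniformizationOnClub hS (h η') fun δ m =>
    if hT : T δ then (hfib δ hT m).toFinset.sup fun n => N (η.ladder δ n) else 0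
  have hgood : ∀ δ, T δ → ∀ᶠ n in Filter.atTop,
      N (η.ladder δ n) ≤ q (ρ (η.ladder δ n)) := by
    intro δ hT
    obtain ⟨M, hM⟩ := Filter.eventually_atTop.1 (hq δ)
    have := hfin δ hT _ (η'.lt δ M)
    rw [← Nat.cofinite_eq_atTop]
    filter_upwards [this.compl_mem_cofinite] with n hn
    have hn : η'.ladder δ M ≤ ρ (η.ladder δ n) := not_lt.1 hn
    obtain ⟨m, hm⟩ : ρ (η.ladder δ n) ∈ Set.range (η'.ladder δ) := by
      rw [hη']
      simp only [W, if_pos hT]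
      exact ⟨n, rfl⟩
    have hMm : M ≤ m := (η'.strictMono δ).le_iff_le.1 (hm ▸ hn)
    have := hM m hMm
    rw [dif_pos hT] at this
    rw [← hm]
    exact (Finset.le_sup (f := fun n => N (η.ladder δ n))
      ((hfib δ hT m).mem_toFinset.2 hm.symm)).trans this
  refine ⟨fun α => if N α ≤ q (ρ α) then f α else F (ρ α) α, fun δ => ?_⟩
  rcases hρ δ (hS δ.2) with ⟨hδ, hT⟩ | ⟨β, γ, hγ, hconst⟩
  · filter_upwards [hf δ hδ, hgood δ hT] with n hn hle
    rw [if_pos hle, hn]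
  · have hbad : {n | η.ladder δ n ∈ {α | ρ α = β ∧ N α ≤ q β}}.Finite := by
      refine Set.Finite.preimage (η.strictMono δ).injective.injOn ?_
      refine Set.Finite.of_finite_image ((Set.finite_Iic (q β)).subset ?_)
        ((hN β).mono fun α hα => hα.1)
      rintro _ ⟨α, hα, rfl⟩
      exact hα.2
    have hbad := hbad.compl_mem_cofinite
    rw [Nat.cofinite_eq_atTop] at hbad
    filter_upwards [hF β δ ⟨γ, hγ, hconst⟩, η.eventually_le δ hγ, hbad] with n hn hle hnb
    have hρn := hconst _ hle (η.lt δ n)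
    rw [hρn, if_neg fun hle' => hnb ⟨hρn, hle'⟩, hn]

end WhiteheadUniformization

/-! ### Groups presented by ladder relations. -/

namespace WhiteheadUniformization

variable {S : Set OmegaOne}

/-- Names of the generators: `inl γ` for `x_γ` and `inr (δ, n)` for `y_{δ,n}`. -/
abbrev Gen (S : Set OmegaOne) : Type 1 := OmegaOne ⊕ (S × ℕ)

/-- The least `γ` such that the generator belongs to the stages of the filtration above `γ`. -/
def Gen.rank : Gen S → OmegaOne
  | .inl γ => γ
  | .inr p => p.1

theorem Gen.countable_rank_lt (α : OmegaOne) : Countable {g : Gen S // g.rank < α} := by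
  have h1 := (OmegaOne.countable_Iio α)
  have h2 := (h1.preimage_of_injOn (f := ((↑) : S → OmegaOne)) Subtype.val_injective.injOn).prod
    (Set.countable_univ (α := ℕ))
  refine ((h1.image Sum.inl).union (h2.image Sum.inr) : Set.Countable _).mono ?_
  rintro (γ | p) hg
  · exact Or.inl ⟨γ, hg, rfl⟩
  · exact Or.inr ⟨p, ⟨hg, trivial⟩, rfl⟩

/-- A ladder system together with the integer coefficients of the relations
`y_{δ,n} = M_{δ,n} y_{δ,n+1} + x_{η_δ(n)} + ∑_{i<n} U_{δ,n,i} x_{η_δ(i)}`. -/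
structure LadderRelations (S : Set OmegaOne) where
  /-- the ladder system -/
  η : LadderSystem S
  /-- the coefficients of `y_{δ,n+1}` -/
  M : S → ℕ → ℤ
  /-- the coefficients of the lower terms -/
  U : S → ℕ → ℕ → ℤ
  ne_zero : ∀ δ n, M δ n ≠ 0

namespace LadderRelations

variable (R : LadderRelations S)

/-- `f` satisfies the relations with inhomogeneous terms `c`. -/
def IsSolution {N : Type*} [AddCommGroup N] (f : Gen S → N) (c : S → ℕ → N) : Prop :=
  ∀ (δ : S) (n : ℕ), f (.inr (δ, n)) = R.M δ n • f (.inr (δ, n + 1)) + f (.inl (R.η.ladder δ n)) +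
    ∑ i ∈ Finset.range n, R.U δ n i • f (.inl (R.η.ladder δ i)) + c δ n

variable {R}

theorem IsSolution.map {N N' : Type*} [AddCommGroup N] [AddCommGroup N'] {f : Gen S → N}
    {c : S → ℕ → N} (h : R.IsSolution f c) (φ : N →ₗ[ℤ] N') :
    R.IsSolution (φ ∘ f) (fun δ n => φ (c δ n)) := fun δ n => by
  simp only [Function.comp_apply]
  rw [h δ n]
  simp only [map_add, map_smul, map_sum]

/-- Over the rationals the values of the `y_{δ,n}` can be computed from those of the `x_γ`. -/
theorem exists_rat_solution {V : Type*} [AddCommGroup V] [Module ℚ V] (fx : OmegaOne → V)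
    (c : S → ℕ → V) : ∃ f : Gen S → V, (∀ γ, f (.inl γ) = fx γ) ∧ R.IsSolution f c := by
  let y : S → ℕ → V := fun δ n => Nat.rec 0 (fun n y => (R.M δ n : ℚ)⁻¹ •
    (y - fx (R.η.ladder δ n) - ∑ i ∈ Finset.range n, R.U δ n i • fx (R.η.ladder δ i) - c δ n)) n
  refine ⟨Sum.elim fx fun p => y p.1 p.2, fun _ => rfl, fun δ n => ?_⟩
  have hM : (R.M δ n : ℚ) ≠ 0 := Int.cast_ne_zero.2 (R.ne_zero δ n)
  have : R.M δ n • y δ (n + 1) = y δ n - fx (R.η.ladder δ n) -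
      ∑ i ∈ Finset.range n, R.U δ n i • fx (R.η.ladder δ i) - c δ n := by
    rw [← Int.cast_smul_eq_zsmul ℚ]
    exact smul_inv_smul₀ hM _
  simp only [Sum.elim_inr, Sum.elim_inl, this]
  abel

end LadderRelations

/-- The free abelian group on the generators, in the lowest universe. -/
abbrev FreeGens (S : Set OmegaOne) : Type := Shrink.{0} (Gen S) →₀ ℤ

namespace FreeGens

/-- The generators of `FreeGens S`. -/
noncomputable def of (g : Gen S) : FreeGens S := Finsupp.single (equivShrink _ g) 1

theorem exists_lift {N : Type*} [AddCommGroup N] (f : Gen S → N) :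
    ∃ φ : FreeGens S →ₗ[ℤ] N, ∀ g, φ (of g) = f g :=
  ⟨Finsupp.linearCombination ℤ fun s => f ((equivShrink _).symm s), fun g => by simp [of]⟩

theorem span_of : Submodule.span ℤ (Set.range (of (S := S))) = ⊤ := by
  rw [← (Finsupp.basisSingleOne (R := ℤ) (ι := Shrink.{0} (Gen S))).span_eq]
  congr 1
  ext a
  constructor
  · rintro ⟨g, rfl⟩
    exact ⟨equivShrink _ g, by simp [of]⟩
  · rintro ⟨s, rfl⟩
    exact ⟨(equivShrink _).symm s, by simp [of]⟩

end FreeGens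

namespace LadderRelations

variable (R : LadderRelations S)

/-- The relators. -/
noncomputable def relator (δ : S) (n : ℕ) : FreeGens S :=
  FreeGens.of (.inr (δ, n)) - R.M δ n • FreeGens.of (.inr (δ, n + 1)) -
    FreeGens.of (.inl (R.η.ladder δ n)) -
    ∑ i ∈ Finset.range n, R.U δ n i • FreeGens.of (.inl (R.η.ladder δ i))

/-- The subgroup of relations. -/
noncomputable def relations : Submodule ℤ (FreeGens S) :=
  Submodule.span ℤ (Set.range fun p : S × ℕ => R.relator p.1 p.2)

/-- The group presented by the relations. -/
abbrev Grp : Type := FreeGens S ⧸ R.relations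

/-- The generators of `R.Grp`. -/
noncomputable def gen (g : Gen S) : R.Grp := R.relations.mkQ (FreeGens.of g)

variable {R}

theorem lift_relator {N : Type*} [AddCommGroup N] {f : Gen S → N} {c : S → ℕ → N}
    (h : R.IsSolution f c) {φ : FreeGens S →ₗ[ℤ] N} (hφ : ∀ g, φ (FreeGens.of g) = f g)
    (δ : S) (n : ℕ) : φ (R.relator δ n) = c δ n := by
  simp only [relator, map_sub, map_smul, map_sum, hφ, h δ n]
  abel

theorem exists_lift {N : Type*} [AddCommGroup N] {f : Gen S → N}
    (h : R.IsSolution f fun _ _ => 0) : ∃ φ : R.Grp →ₗ[ℤ] N, ∀ g, φ (R.gen g) = f g := by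
  obtain ⟨φ, hφ⟩ := FreeGens.exists_lift f
  refine ⟨R.relations.liftQ φ (Submodule.span_le.2 ?_), fun g => hφ g⟩
  rintro _ ⟨p, rfl⟩
  exact lift_relator h hφ p.1 p.2

variable (R)

theorem isSolution_gen : R.IsSolution R.gen fun _ _ => 0 := by
  intro δ n
  have h : R.relations.mkQ (R.relator δ n) = 0 :=
    (Submodule.Quotient.mk_eq_zero _).2 (Submodule.subset_span ⟨(δ, n), rfl⟩)
  simp only [relator, map_sub, map_smul, map_sum] at h
  rw [add_zero, ← sub_eq_zero, ← h]
  simp only [gen]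
  abel

theorem span_gen : Submodule.span ℤ (Set.range R.gen) = ⊤ := by
  have : Set.range R.gen = R.relations.mkQ '' Set.range FreeGens.of := by
    rw [← Set.range_comp]
    rfl
  rw [this, ← Submodule.map_span, FreeGens.span_of, Submodule.map_top, Submodule.range_mkQ]

/-- If the group presented by the relations is a Whitehead group, then all inhomogeneous systems
have integral solutions. -/
theorem exists_int_solution (h : IsWhitehead R.Grp) (c : S → ℕ → ℤ) :
    ∃ f : Gen S → ℤ, R.IsSolution f c := by
  -- A rational solution defines a homomorphism sending each relator to the corresponding integer
  -- `c`. Its restriction to the relations is integral, and extending that restriction to the free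
  -- group gives integral values at the generators.
  obtain ⟨q, -, hq⟩ := exists_rat_solution (R := R) (fun _ => (0 : ℚ)) fun δ n => (c δ n : ℚ)
  obtain ⟨φ, hφ⟩ := FreeGens.exists_lift q
  have hrel := lift_relator hq hφ
  let j : ℤ →ₗ[ℤ] ℚ := Algebra.linearMap ℤ ℚ
  have hj : Function.Injective j := fun a b h => Int.cast_injective (α := ℚ) h
  have hK : R.relations.map φ ≤ LinearMap.range j := by
    rw [relations, Submodule.map_span, Submodule.span_le]
    rintro _ ⟨_, ⟨p, rfl⟩, rfl⟩
    exact ⟨c p.1 p.2, (hrel p.1 p.2).symm⟩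
  let χ : R.relations →ₗ[ℤ] ℤ := (LinearEquiv.ofInjective j hj).symm.toLinearMap ∘ₗ
    LinearMap.codRestrict (LinearMap.range j) (φ ∘ₗ R.relations.subtype)
      fun k => hK ⟨k, k.2, rfl⟩
  have hχ : ∀ k, j (χ k) = φ k := fun k => by
    have := congrArg Subtype.val ((LinearEquiv.ofInjective j hj).apply_symm_apply
      (LinearMap.codRestrict (LinearMap.range j) (φ ∘ₗ R.relations.subtype)
      (fun k => hK ⟨k, k.2, rfl⟩) k))
    exact this
  obtain ⟨ψ, hψ⟩ := h.exists_extension R.relations χ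
  refine ⟨fun g => ψ (FreeGens.of g), fun δ n => ?_⟩
  have hmem : R.relator δ n ∈ R.relations := Submodule.subset_span ⟨(δ, n), rfl⟩
  have h1 : ψ (R.relator δ n) = c δ n := hj <| by
    rw [hψ ⟨_, hmem⟩, hχ]
    exact hrel δ n
  simp only [relator, map_sub, map_smul, map_sum] at h1
  linarith

/-- The subgroup generated by the generators of rank less than `α`. -/
noncomputable def stage (α : OmegaOne) : Submodule ℤ R.Grp :=
  Submodule.span ℤ (Set.range fun g : {g : Gen S // g.rank < α} => R.gen g)

variable {R}

theorem gen_mem_stage {g : Gen S} {α : OmegaOne} (h : g.rank < α) : R.gen g ∈ R.stage α :=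
  Submodule.subset_span ⟨⟨g, h⟩, rfl⟩

variable (R)

theorem stage_mono : Monotone R.stage := fun _ _ h => Submodule.span_mono <| by
  rintro _ ⟨g, rfl⟩
  exact ⟨⟨g, g.2.trans_le h⟩, rfl⟩

theorem countable_stage (α : OmegaOne) : Countable (R.stage α) := by
  have := Gen.countable_rank_lt (S := S) α
  exact inferInstanceAs (Countable (Submodule.span ℤ (Set.range _)))

theorem exists_mem_stage (a : R.Grp) : ∃ α, a ∈ R.stage α := by
  have ha : a ∈ Submodule.span ℤ (Set.range R.gen) := R.span_gen ▸ Submodule.mem_top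
  induction ha using Submodule.span_induction with
  | mem x hx =>
    obtain ⟨g, rfl⟩ := hx
    obtain ⟨β, hβ⟩ := exists_gt g.rank
    exact ⟨β, gen_mem_stage hβ⟩
  | zero => exact ⟨Classical.arbitrary _, zero_mem _⟩
  | add x y _ _ hx hy =>
    obtain ⟨α, hα⟩ := hx
    obtain ⟨β, hβ⟩ := hy
    exact ⟨max α β, add_mem (R.stage_mono (le_max_left _ _) hα)
      (R.stage_mono (le_max_right _ _) hβ)⟩
  | smul n x _ hx => exact hx.imp fun α hα => Submodule.smul_mem _ n hα

theorem exists_lt_mem_stage {α : OmegaOne} (hα : α ∈ limOmegaOne) {a : R.Grp}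
    (ha : a ∈ R.stage α) : ∃ β < α, a ∈ R.stage β := by
  induction ha using Submodule.span_induction with
  | mem x hx =>
    obtain ⟨g, rfl⟩ := hx
    obtain ⟨β, hβ, hβα⟩ := exists_between_of_mem_limOmegaOne hα g.2
    exact ⟨β, hβα, gen_mem_stage hβ⟩
  | zero =>
    obtain ⟨β, hβ⟩ := not_isMin_iff.1 hα.1
    exact ⟨β, hβ, zero_mem _⟩
  | add x y _ _ hx hy =>
    obtain ⟨β, hβ, hx⟩ := hx
    obtain ⟨γ, hγ, hy⟩ := hy
    exact ⟨max β γ, max_lt hβ hγ, add_mem (R.stage_mono (le_max_left _ _) hx)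
      (R.stage_mono (le_max_right _ _) hy)⟩
  | smul n x _ hx => exact hx.imp fun β h => ⟨h.1, Submodule.smul_mem _ n h.2⟩

/-- The `ω₁`-filtration of `R.Grp` by its stages. -/
noncomputable def filtration : OmegaOneFiltration R.Grp where
  toFun α := (R.stage α).toAddSubgroup
  monotone _ _ h := R.stage_mono h
  countable := R.countable_stage
  continuous _ hα _ ha := R.exists_lt_mem_stage hα ha
  exhaustive := R.exists_mem_stage

/-- Over `ℚ` the values at the `x_γ` can be prescribed freely. This gives the lower bound for the
cardinality of the group. -/
theorem gen_inl_injective : Function.Injective fun γ : OmegaOne => R.gen (.inl γ) := by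
  obtain ⟨f, hf, hsol⟩ := exists_rat_solution (R := R)
    (fun γ => (Finsupp.single γ 1 : OmegaOne →₀ ℚ)) fun _ _ => 0
  obtain ⟨φ, hφ⟩ := exists_lift hsol
  intro γ γ' h
  have h := congrArg φ h
  simp only [hφ, hf] at h
  exact Finsupp.single_left_injective one_ne_zero h

theorem mk_grp : #R.Grp = ℵ₁ := by
  have hinf : ℵ₀ ≤ Cardinal.lift.{1, 0} ℵ₁ := by simp
  refine le_antisymm ?_ ?_
  · have hS : #S ≤ Cardinal.lift.{1, 0} ℵ₁ := OmegaOne.mk_eq ▸ Cardinal.mk_set_le S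
    have hgen : #(Gen S) ≤ Cardinal.lift.{1, 0} ℵ₁ := by
      simp only [Cardinal.mk_sum, Cardinal.mk_prod, Cardinal.lift_id, OmegaOne.mk_eq,
        Cardinal.mk_eq_aleph0, Cardinal.lift_aleph0, Cardinal.lift_uzero]
      exact Cardinal.add_le_of_le hinf le_rfl (Cardinal.mul_le_of_le hinf hS hinf)
    have hshrink : #(Shrink.{0} (Gen S)) ≤ ℵ₁ := by
      have he : Cardinal.lift.{1, 0} #(Shrink.{0} (Gen S)) = Cardinal.lift.{0, 1} #(Gen S) :=
        Cardinal.lift_mk_eq'.2 ⟨(equivShrink _).symm⟩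
      rw [← Cardinal.lift_le.{1, 0}, he, Cardinal.lift_uzero]
      exact hgen
    refine (Cardinal.mk_le_of_surjective R.relations.mkQ_surjective).trans ?_
    by_cases hfin : Infinite (Shrink.{0} (Gen S))
    · rw [Cardinal.mk_finsupp_of_infinite]
      exact max_le hshrink (by simp [aleph0_le_aleph])
    · have := not_infinite_iff_finite.1 hfin
      exact ((Cardinal.mk_le_aleph0 (α := FreeGens S))).trans (aleph0_le_aleph 1)
  · have := Cardinal.mk_le_of_injective
      ((ULift.up_injective (α := R.Grp)).comp R.gen_inl_injective)
    rw [OmegaOne.mk_eq, Cardinal.mk_uLift, Cardinal.lift_le] at this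
    exact this

end LadderRelations
end WhiteheadUniformization

/-! ### Freeness of countable subgroups of the quotients by stages. -/

namespace WhiteheadUniformization

/-- Well-founded recursion, with the recursive values presented as a truncated function. -/
theorem exists_recursive {Z : Type*} [Zero Z] (Ψ : OmegaOne → (OmegaOne → Z) → Z) :
    ∃ z : OmegaOne → Z, ∀ γ, z γ = Ψ γ ((Set.Iio γ).indicator z) := by
  classical
  let F : (γ : OmegaOne) → ((γ' : OmegaOne) → γ' < γ → Z) → Z := fun γ r =>
    Ψ γ fun γ' => if h : γ' < γ then r γ' h else 0
  refine ⟨wellFounded_lt.fix F, fun γ => ?_⟩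
  rw [wellFounded_lt.fix_eq]
  simp only [F]
  congr 1
  ext γ'
  by_cases h : γ' < γ
  · rw [dif_pos h, Set.indicator_of_mem (show γ' ∈ Set.Iio γ from h)]
  · rw [dif_neg h, Set.indicator_of_notMem (show γ' ∉ Set.Iio γ from h)]

/-- A backward recurrence can be solved with prescribed tail. -/
theorem exists_backward_solution {N : Type*} [AddCommGroup N] (M : ℕ → ℤ) (X : ℕ → N) (t : ℕ) :
    ∀ τ : ℕ → N, (∀ n ≥ t, τ n = M n • τ (n + 1) + X n) →
      ∃ τ' : ℕ → N, (∀ n, τ' n = M n • τ' (n + 1) + X n) ∧ ∀ n ≥ t, τ' n = τ n := by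
  induction t with
  | zero => exact fun τ h => ⟨τ, fun n => h n (Nat.zero_le n), fun _ _ => rfl⟩
  | succ t ih =>
    intro τ h
    have hne : ∀ n, t + 1 ≤ n → n ≠ t := fun n hn => (Nat.lt_of_succ_le hn).ne'
    obtain ⟨τ', h1, h2⟩ := ih (Function.update τ t (M t • τ (t + 1) + X t)) fun n hn => by
      rcases hn.lt_or_eq with hn | rfl
      · rw [Function.update_of_ne (hne n hn), Function.update_of_ne (hne _ (by omega))]
        exact h n hn
      · rw [Function.update_self, Function.update_of_ne (hne _ le_rfl)]
    refine ⟨τ', h1, fun n hn => ?_⟩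
    rw [h2 n (by omega), Function.update_of_ne (hne n hn)]

variable {S : Set OmegaOne}

namespace LadderRelations

variable (R : LadderRelations S)

/-- If `α ∉ S`, the values of a solution below `β` can be computed, over `ℤ`, in terms of free
parameters, namely the values of some of the generators between `α` and `β`. -/
theorem exists_parametrization {α : OmegaOne} (hα : α ∉ S) (β : OmegaOne) :
    ∃ z : Gen S → Gen S →₀ ℤ,
      (∀ (δ : S) (n : ℕ), (δ : OmegaOne) < β → z (.inr (δ, n)) =
        R.M δ n • z (.inr (δ, n + 1)) + z (.inl (R.η.ladder δ n)) +
          ∑ i ∈ Finset.range n, R.U δ n i • z (.inl (R.η.ladder δ i))) ∧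
      (∀ g : Gen S, g.rank < α → z g = 0) ∧
      ∀ σ : (Gen S →₀ ℤ) →ₗ[ℤ] R.Grp ⧸ R.stage α,
        (∀ g, σ (Finsupp.single g 1) = (R.stage α).mkQ (R.gen g)) →
        ∀ g : Gen S, g.rank < β → σ (z g) = (R.stage α).mkQ (R.gen g) := by
  classical
  let e : Gen S → Gen S →₀ ℤ := fun g => Finsupp.single g 1
  let D : Set S := {δ | α < (δ : OmegaOne) ∧ (δ : OmegaOne) < β}
  have hD : D.Countable :=
    ((OmegaOne.countable_Iio β).preimage_of_injOn Subtype.val_injective.injOn).mono fun δ h => h.2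
  obtain ⟨t, htα, ht⟩ := R.η.exists_disjoint_tails hD α fun δ h => h.1
  let tail : OmegaOne → S × ℕ → Prop := fun γ p =>
    p.1 ∈ D ∧ t p.1 ≤ p.2 ∧ R.η.ladder p.1 p.2 = γ
  -- At a point of one of the disjoint tails, the relation is solved for `x_γ`, whose coefficient is
  -- `1`; it involves only `x` at smaller ordinals. The `y_{δ,n}` on the tails and the remaining
  -- `x_γ` are the free parameters.
  obtain ⟨x, hx⟩ := exists_recursive (Z := Gen S →₀ ℤ) fun γ r =>
    if γ < α then 0 else if h : ∃ p, tail γ p then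
      e (.inr h.choose) - R.M h.choose.1 h.choose.2 • e (.inr (h.choose.1, h.choose.2 + 1)) -
        ∑ i ∈ Finset.range h.choose.2, R.U h.choose.1 h.choose.2 i •
          r (R.η.ladder h.choose.1 i)
    else e (.inl γ)
  have hx0 : ∀ γ < α, x γ = 0 := fun γ hγ => by rw [hx, if_pos hγ]
  have hxt : ∀ δ ∈ D, ∀ n ≥ t δ, x (R.η.ladder δ n) = e (.inr (δ, n)) -
      R.M δ n • e (.inr (δ, n + 1)) -
        ∑ i ∈ Finset.range n, R.U δ n i • x (R.η.ladder δ i) := by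
    intro δ hδ n hn
    have h : ∃ p, tail (R.η.ladder δ n) p := ⟨(δ, n), hδ, hn, rfl⟩
    have hp : h.choose = (δ, n) := by
      obtain ⟨h1, h2, h3⟩ := h.choose_spec
      generalize h.choose = p at h1 h2 h3
      obtain ⟨δ', n'⟩ := p
      obtain rfl := ht δ' h1 δ hδ n' h2 n hn h3
      exact Prod.ext rfl ((R.η.strictMono _).injective h3)
    rw [hx, if_neg (htα δ hδ n hn).not_gt, dif_pos h, hp]
    congr 1
    refine Finset.sum_congr rfl fun i hi => ?_
    rw [Set.indicator_of_mem]
    exact R.η.strictMono δ (Finset.mem_range.1 hi)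
  have hy : ∀ δ : S, ∃ y : ℕ → Gen S →₀ ℤ, ((δ : OmegaOne) < β → ∀ n, y n =
      R.M δ n • y (n + 1) + (x (R.η.ladder δ n) +
        ∑ i ∈ Finset.range n, R.U δ n i • x (R.η.ladder δ i))) ∧
      ((δ : OmegaOne) < α → ∀ n, y n = 0) ∧ (δ ∈ D → ∀ n ≥ t δ, y n = e (.inr (δ, n))) := by
    intro δ
    by_cases hδ : δ ∈ D
    · obtain ⟨y, h1, h2⟩ := exists_backward_solution (R.M δ)
        (fun n => x (R.η.ladder δ n) + ∑ i ∈ Finset.range n, R.U δ n i • x (R.η.ladder δ i)) (t δ)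
        (fun n => e (.inr (δ, n))) fun n hn => by
          simp only [hxt δ hδ n hn]
          abel
      exact ⟨y, fun _ => h1, fun h => absurd h hδ.1.not_gt, fun _ => h2⟩
    · refine ⟨fun _ => 0, fun hδβ n => ?_, fun _ _ => rfl, fun h => absurd h hδ⟩
      -- Here `α ∉ S` excludes `δ = α`, whose `x` terms all vanish while its `y` terms lie outside
      -- the stage.
      have hδα : (δ : OmegaOne) < α := lt_of_le_of_ne
        (not_lt.1 fun h => hδ ⟨h, hδβ⟩) fun h => hα (h ▸ δ.2)
      have h0 : ∀ i, x (R.η.ladder δ i) = 0 := fun i => hx0 _ ((R.η.lt δ i).trans hδα)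
      simp [h0]
  choose y hyrec hy0 hyt using hy
  refine ⟨Sum.elim x fun p => y p.1 p.2, fun δ n hδ => ?_, ?_, fun σ hσ => ?_⟩
  · simp only [Sum.elim_inr, Sum.elim_inl]
    rw [add_assoc]
    exact hyrec δ hδ n
  · rintro (γ | ⟨δ, n⟩) h
    · exact hx0 γ h
    · exact hy0 δ h n
  · have hσe : ∀ g, σ (e g) = (R.stage α).mkQ (R.gen g) := hσ
    have hgen : ∀ δ n, (R.stage α).mkQ (R.gen (.inr (δ, n))) =
        R.M δ n • (R.stage α).mkQ (R.gen (.inr (δ, n + 1))) +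
        ((R.stage α).mkQ (R.gen (.inl (R.η.ladder δ n))) +
          ∑ i ∈ Finset.range n, R.U δ n i •
            (R.stage α).mkQ (R.gen (.inl (R.η.ladder δ i)))) := by
      intro δ n
      have := (R.isSolution_gen).map (R.stage α).mkQ δ n
      simpa only [Function.comp_apply, map_zero, add_zero, add_assoc] using this
    have hlow : ∀ g : Gen S, g.rank < α → (R.stage α).mkQ (R.gen g) = 0 := fun g hg =>
      (Submodule.Quotient.mk_eq_zero _).2 (gen_mem_stage hg)
    have hσx : ∀ γ : OmegaOne, σ (x γ) = (R.stage α).mkQ (R.gen (.inl γ)) := by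
      intro γ
      induction γ using WellFoundedLT.induction with
      | ind γ ih =>
      by_cases hγ : γ < α
      · rw [hx0 γ hγ, map_zero, hlow (.inl γ) hγ]
      by_cases h : ∃ p, tail γ p
      · obtain ⟨⟨δ, n⟩, h1, h2, rfl⟩ := h
        rw [hxt δ h1 n h2]
        simp only [map_sub, map_smul, map_sum, hσe]
        rw [Finset.sum_congr rfl fun i hi => by
          rw [ih _ (R.η.strictMono δ (Finset.mem_range.1 hi))], hgen]
        abel
      · rw [hx, if_neg hγ, dif_neg h, hσe]
    rintro (γ | ⟨δ, n⟩) h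
    · exact hσx γ
    · change (δ : OmegaOne) < β at h
      change σ (y δ n) = _
      by_cases hδ : δ ∈ D
      · have key : ∀ k m, t δ ≤ m + k →
            σ (y δ m) = (R.stage α).mkQ (R.gen (.inr (δ, m))) := by
          intro k
          induction k with
          | zero =>
            intro m hm
            rw [hyt δ hδ m hm, hσe]
          | succ k ih =>
            intro m hm
            rw [hyrec δ h m, hgen]
            simp only [map_add, map_smul, map_sum, hσx]
            rw [ih (m + 1) (by omega)]
        exact key (t δ) n (Nat.le_add_left _ _)
      · have hδα : (δ : OmegaOne) < α := lt_of_le_of_ne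
          (not_lt.1 fun h' => hδ ⟨h', h⟩) fun h => hα (h ▸ δ.2)
        rw [hy0 δ hδα, map_zero, hlow (.inr (δ, n)) hδα]

/-- The quotient by a stage outside `S` is `ℵ₁`-free. -/
theorem isAlephOneFree_quotient {α : OmegaOne} (hα : α ∉ S) :
    IsAlephOneFree (R.Grp ⧸ R.stage α) := by
  classical
  intro B hB
  choose lift hlift using fun b : B => (R.stage α).mkQ_surjective (b : R.Grp ⧸ R.stage α)
  choose rk hrk using fun b : B => R.exists_mem_stage (lift b)
  obtain ⟨β, hβ⟩ := OmegaOne.exists_gt_of_countable ((Set.countable_range rk).insert α)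
  obtain ⟨z, hz, hz0, hzσ⟩ := R.exists_parametrization hα β
  let j : (Gen S →₀ ℤ) →ₗ[ℤ] (Gen S →₀ ℚ) :=
    Finsupp.mapRange.linearMap (Algebra.linearMap ℤ ℚ)
  have hj : Function.Injective j :=
    Finsupp.mapRange_injective _ (map_zero _) (Int.cast_injective (α := ℚ))
  obtain ⟨q, hqx, hq⟩ := exists_rat_solution (R := R) (fun γ => j (z (.inl γ))) fun _ _ => 0
  -- The integral solution below `β` is continued rationally, so that it defines a map on the whole
  -- group. On the stage `β` it is integral, and `σ` recovers the class modulo the stage `α`; this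
  -- makes the map injective on `B`.
  let f : Gen S → Gen S →₀ ℚ := fun g => if g.rank < β then j (z g) else q g
  have hfx : ∀ γ, f (.inl γ) = j (z (.inl γ)) := fun γ => by
    by_cases h : Gen.rank (S := S) (.inl γ) < β
    · exact if_pos h
    · exact (if_neg h).trans (hqx γ)
  have hf : R.IsSolution f fun _ _ => 0 := by
    intro δ n
    by_cases h : (δ : OmegaOne) < β
    · have h1 : ∀ m, f (.inr (δ, m)) = j (z (.inr (δ, m))) := fun m => if_pos h
      rw [h1, h1, hz δ n h]
      simp only [hfx, map_add, map_smul, map_sum, add_zero]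
    · have h1 : ∀ m, f (.inr (δ, m)) = q (.inr (δ, m)) := fun m => if_neg h
      rw [h1, h1, hq δ n]
      simp only [hfx, hqx]
  obtain ⟨θ, hθ⟩ := exists_lift hf
  obtain ⟨σ, hσ⟩ : ∃ σ : (Gen S →₀ ℤ) →ₗ[ℤ] R.Grp ⧸ R.stage α,
      ∀ g, σ (Finsupp.single g 1) = (R.stage α).mkQ (R.gen g) :=
    ⟨Finsupp.linearCombination ℤ fun g => (R.stage α).mkQ (R.gen g), fun g => by simp⟩
  have hint : ∀ a ∈ R.stage β, ∃ w, j w = θ a ∧ σ w = (R.stage α).mkQ a := by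
    intro a ha
    induction ha using Submodule.span_induction with
    | mem x hx =>
      obtain ⟨g, rfl⟩ := hx
      exact ⟨z g, by rw [hθ]; exact (if_pos g.2).symm, hzσ σ hσ g g.2⟩
    | zero => exact ⟨0, by simp, by simp⟩
    | add x y _ _ hx hy =>
      obtain ⟨w, h1, h2⟩ := hx
      obtain ⟨w', h1', h2'⟩ := hy
      exact ⟨w + w', by simp [h1, h1'], by simp [h2, h2']⟩
    | smul n x _ hx =>
      obtain ⟨w, h1, h2⟩ := hx
      exact ⟨n • w, by rw [map_smul, map_smul, h1], by rw [map_smul, map_smul, h2]⟩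
  have hα0 : R.stage α ≤ LinearMap.ker θ := by
    rw [stage, Submodule.span_le]
    rintro _ ⟨⟨g, hg⟩, rfl⟩
    change θ (R.gen g) = 0
    rw [hθ]
    obtain (γ | ⟨δ, n⟩) := g
    · rw [hfx, hz0 _ hg, map_zero]
    · exact (if_pos (lt_trans hg (hβ _ (Set.mem_insert _ _)))).trans (by rw [hz0 _ hg, map_zero])
  let θ' : (R.Grp ⧸ R.stage α) →ₗ[ℤ] (Gen S →₀ ℚ) := (R.stage α).liftQ θ hα0
  have hB' : ∀ b : B, ∃ w, j w = θ' b ∧ σ w = b := by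
    intro b
    obtain ⟨w, h1, h2⟩ := hint (lift b) (R.stage_mono (hβ _ (Set.mem_insert_of_mem _ ⟨b, rfl⟩)).le (hrk b))
    refine ⟨w, ?_, h2.trans (hlift b)⟩
    rw [h1, ← hlift b]
    rfl
  choose w hw hwσ using hB'
  let ψ : B →+ (Gen S →₀ ℤ) :=
    { toFun := w
      map_zero' := hj (by rw [hw]; simp)
      map_add' := fun b b' => hj (by rw [map_add, hw, hw, hw]; simp) }
  refine free_of_injective_finsupp ψ.toIntLinearMap fun b b' h => Subtype.ext ?_
  rw [← hwσ b, ← hwσ b']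
  exact congrArg σ h

end LadderRelations
end WhiteheadUniformization

/-! ### The presented groups satisfy the hypotheses of (2). -/

namespace WhiteheadUniformization

theorem IsAlephOneFree.of_addEquiv {A A' : Type*} [AddCommGroup A] [AddCommGroup A']
    (h : IsAlephOneFree A) (e : A' ≃+ A) : IsAlephOneFree A' := by
  intro B hB
  have : Countable (B.map e.toAddMonoidHom) := (e.addSubgroupMap B).toEquiv.symm.countable_iff.2 hB
  have := h (B.map e.toAddMonoidHom) this
  have : Module.Free ℤ (B.map (e : A' →+ A)) := this
  exact Module.Free.of_equiv (e.addSubgroupMap B).symm.toIntLinearEquiv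

variable {S : Set OmegaOne}

namespace LadderRelations

variable (R : LadderRelations S)

theorem gammaSubset : GammaSubset R.Grp S := by
  refine ⟨R.filtration, ?_⟩
  have : R.filtration.nonFreeSet \ S = ∅ := by
    rw [Set.sdiff_eq_empty]
    intro α hα
    by_contra hαS
    exact hα (R.isAlephOneFree_quotient hαS)
  rw [this]
  exact not_isStationary_empty

theorem isAlephOneFree (hS : S ⊆ limOmegaOne) : IsAlephOneFree R.Grp := by
  let o : OmegaOne := ⟨0, omega_pos 1⟩
  have hmin : ∀ γ : OmegaOne, ¬ γ < o := fun γ h => not_lt_zero (show (γ : Ordinal) < 0 from h)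
  have ho : o ∉ S := fun h => (hS h).1 fun γ _ => not_lt.1 (hmin γ)
  have hbot : R.stage o = ⊥ := by
    rw [stage, Submodule.span_eq_bot]
    rintro _ ⟨g, rfl⟩
    exact absurd g.2 (hmin _)
  exact (R.isAlephOneFree_quotient ho).of_addEquiv
    (Submodule.quotEquivOfEqBot _ hbot).symm.toAddEquiv

/-- A countable set lies in a stage indexed by a successor ordinal, which is not in `S`. -/
theorem isStronglyAlephOneFree (hS : S ⊆ limOmegaOne) : IsStronglyAlephOneFree R.Grp := by
  intro X hX
  choose rk hrk using R.exists_mem_stage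
  obtain ⟨γ, hγ⟩ := OmegaOne.exists_gt_of_countable (hX.image rk)
  obtain ⟨β, hγβ, hβ⟩ : ∃ β, γ < β ∧ ∀ β', γ < β' → β ≤ β' :=
    ⟨_, wellFounded_lt.min_mem {β | γ < β} (exists_gt γ),
      fun β' h => not_lt.1 (wellFounded_lt.not_lt_min {β | γ < β} h)⟩
  have hβS : β ∉ S := fun h =>
    (hS h).isSuccPrelimit γ ⟨hγβ, fun c hc => not_lt.2 (hβ c hc)⟩
  exact ⟨(R.stage β).toAddSubgroup,
    fun x hx => R.stage_mono ((hγ _ ⟨x, hx, rfl⟩).trans hγβ).le (hrk x),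
    R.isAlephOneFree hS _ (R.countable_stage β), R.isAlephOneFree_quotient hβS⟩

end LadderRelations

/-- If all the groups in question are Whitehead groups, then all inhomogeneous systems attached to
ladder systems have integral solutions. -/
theorem AllWhitehead.exists_solution (h : AllWhitehead S) (hS : S ⊆ limOmegaOne)
    (η : LadderSystem S) {M : S → ℕ → ℤ} (hM : ∀ δ n, M δ n ≠ 0) (U : S → ℕ → ℕ → ℤ)
    (c : S → ℕ → ℤ) : ∃ (f : OmegaOne → ℤ) (y : S → ℕ → ℤ), ∀ δ n,
      y δ n = M δ n * y δ (n + 1) + f (η.ladder δ n) +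
        ∑ i ∈ Finset.range n, U δ n i * f (η.ladder δ i) + c δ n := by
  let R : LadderRelations S := ⟨η, M, U, hM⟩
  obtain ⟨f, hf⟩ := R.exists_int_solution
    (h R.Grp R.mk_grp (R.isStronglyAlephOneFree hS) R.gammaSubset) c
  exact ⟨fun γ => f (.inl γ), fun δ n => f (.inr (δ, n)), hf⟩

end WhiteheadUniformization

/-! ### Imposing congruences through the recurrence. -/

namespace WhiteheadUniformization

/-- The recurrence `y_n = M_n y_{n+1} + f_n + ∑_{i<n} U_{n,i} f_i + c_n` with pairwise coprime `M_n`
can be used to impose arbitrary congruences modulo the `M_n` on the `f_n`, up to `y_0`. -/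
theorem exists_coefficients_of_congruences (M : ℕ → ℤ)
    (hM : ∀ i j, i ≠ j → IsCoprime (M i) (M j)) (E : ℕ → ℕ → ℤ) (Γ : ℕ → ℤ) :
    ∃ (U : ℕ → ℕ → ℤ) (c : ℕ → ℤ), ∀ f y : ℕ → ℤ,
      (∀ n, y n = M n * y (n + 1) + f n + ∑ i ∈ Finset.range n, U n i * f i + c n) →
      ∀ n, M n ∣ (∏ i ∈ Finset.range n, M i) * (f n + ∑ i ∈ Finset.range n, E n i * f i) -
        (y 0 + Γ n) := by
  let P : ℕ → ℤ := fun n => ∏ i ∈ Finset.range n, M i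
  have hP : ∀ n, IsCoprime (P n) (M n) := fun n =>
    IsCoprime.prod_left fun i hi => hM i n (Finset.mem_range.1 hi).ne
  choose r s hrs using hP
  -- `L n` and `C n` are the coefficients and the constant when `y_0` is expanded down to `P n *
  -- y_n`. As `r n` inverts `P n` modulo `M n`, the choice of `U` and `c` replaces them by `P n * E
  -- n` and `-Γ n`.
  let L : ℕ → ℕ → ℤ := fun n => Nat.rec (fun _ => 0) (fun n l i =>
    if i < n then l i + P n * (E n i - r n * l i) else P n) n
  let C : ℕ → ℤ := fun n => Nat.rec 0 (fun n C => C + P n * (-(r n * (C + Γ n)))) n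
  refine ⟨fun n i => E n i - r n * L n i, fun n => -(r n * (C n + Γ n)), fun f y h => ?_⟩
  have key : ∀ n, y 0 = P n * y n + ∑ i ∈ Finset.range n, L n i * f i + C n := by
    intro n
    induction n with
    | zero => simp [P, C]
    | succ n ih =>
      have hL : ∑ i ∈ Finset.range (n + 1), L (n + 1) i * f i =
          ∑ i ∈ Finset.range n, L n i * f i +
            P n * ∑ i ∈ Finset.range n, (E n i - r n * L n i) * f i + P n * f n := by
        rw [Finset.sum_range_succ, Finset.mul_sum, ← Finset.sum_add_distrib]
        congr 1
        · refine Finset.sum_congr rfl fun i hi => ?_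
          have : L (n + 1) i = L n i + P n * (E n i - r n * L n i) :=
            if_pos (Finset.mem_range.1 hi)
          rw [this]
          ring
        · have : L (n + 1) n = P n := if_neg (lt_irrefl n)
          rw [this]
      have hC : C (n + 1) = C n + P n * (-(r n * (C n + Γ n))) := rfl
      have hPs : P (n + 1) = P n * M n := Finset.prod_range_succ _ _
      rw [hL, hC, hPs, ih, h n]
      ring
  intro n
  have hE : ∑ i ∈ Finset.range n, E n i * f i =
      ∑ i ∈ Finset.range n, (E n i - r n * L n i) * f i +
        r n * ∑ i ∈ Finset.range n, L n i * f i := by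
    rw [Finset.mul_sum, ← Finset.sum_add_distrib]
    exact Finset.sum_congr rfl fun i _ => by ring
  refine ⟨-(s n * ∑ i ∈ Finset.range n, L n i * f i + P n * y (n + 1) + s n * (C n + Γ n)), ?_⟩
  rw [hE, key n, h n]
  linear_combination (∑ i ∈ Finset.range n, L n i * f i + C n + Γ n) * hrs n

/-- The recurrence can be used to make `f` eventually injective. -/
theorem exists_coefficients_of_injective :
    ∃ (M : ℕ → ℤ) (U : ℕ → ℕ → ℤ) (c : ℕ → ℤ), (∀ n, M n ≠ 0) ∧ ∀ f y : ℕ → ℤ,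
      (∀ n, y n = M n * y (n + 1) + f n + ∑ i ∈ Finset.range n, U n i * f i + c n) →
      ∃ N, ∀ n ≥ N, ∀ i < n, f n ≠ f i := by
  let q : ℕ → ℕ → ℕ := fun n i => Nat.nth Nat.Prime (Nat.pair (2 * n) i)
  have hq : ∀ n i, (q n i).Prime := fun n i => Nat.prime_nth_prime _
  have hinj : ∀ n i n' i', q n i = q n' i' → n = n' ∧ i = i' := by
    intro n i n' i' h
    have := Nat.pair_eq_pair.1 (Nat.nth_injective Nat.infinite_setOfPred_prime h)
    omega
  have hlarge : ∀ n i, 2 * n + 2 ≤ q n i := fun n i =>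
    (Nat.add_le_add_right (Nat.left_le_pair _ _) 2).trans (Nat.add_two_le_nth_prime _)
  have hcop : ∀ n i n' i', (n ≠ n' ∨ i ≠ i') → IsCoprime (q n i : ℤ) (q n' i' : ℤ) := by
    intro n i n' i' h
    rw [Nat.isCoprime_iff_coprime, Nat.coprime_primes (hq _ _) (hq _ _)]
    intro heq
    have := hinj _ _ _ _ heq
    tauto
  let M : ℕ → ℤ := fun n => ∏ i ∈ Finset.range n, (q n i : ℤ)
  -- By the Chinese remainder theorem; modulo `q n i` the combination of the `f j` then becomes `f n
  -- - f i`.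
  have hE : ∀ n j, ∃ e : ℤ, ∀ i < n, (q n i : ℤ) ∣ e + if i = j then 1 else 0 := by
    intro n j
    obtain ⟨a, b, hab⟩ : IsCoprime (∏ k ∈ (Finset.range n).erase j, (q n k : ℤ)) (q n j) :=
      IsCoprime.prod_left fun k hk => hcop _ _ _ _ (Or.inr (Finset.ne_of_mem_erase hk))
    refine ⟨-(a * ∏ k ∈ (Finset.range n).erase j, (q n k : ℤ)), fun i hi => ?_⟩
    split_ifs with hij
    · subst hij
      exact ⟨b, by linear_combination (-1 : ℤ) * hab⟩
    · rw [add_zero, dvd_neg]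
      exact (Finset.dvd_prod_of_mem (fun k => (q n k : ℤ))
        (Finset.mem_erase.2 ⟨hij, Finset.mem_range.2 hi⟩)).mul_left _
  choose E hE using hE
  obtain ⟨U, c, hUc⟩ := exists_coefficients_of_congruences M
    (fun i j hij => IsCoprime.prod_left fun k _ => IsCoprime.prod_right fun l _ =>
      hcop _ _ _ _ (Or.inl hij)) E fun n => n + 1
  refine ⟨M, U, c, fun n => Finset.prod_ne_zero_iff.2 fun i _ =>
    Int.natCast_ne_zero.2 (hq n i).ne_zero, fun f y h => ⟨(y 0).natAbs, fun n hn i hi heq => ?_⟩⟩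
  have h1 : (q n i : ℤ) ∣ M n :=
    Finset.dvd_prod_of_mem (fun k => (q n k : ℤ)) (Finset.mem_range.2 hi)
  have h2 : (q n i : ℤ) ∣ f n + ∑ j ∈ Finset.range n, E n j * f j := by
    have : f n + ∑ j ∈ Finset.range n, E n j * f j =
        ∑ j ∈ Finset.range n, (E n j + if i = j then 1 else 0) * f j := by
      simp only [add_mul, Finset.sum_add_distrib, ite_mul, one_mul, zero_mul,
        Finset.sum_ite_eq, Finset.mem_range, if_pos hi, heq]
      ring
    rw [this]
    exact Finset.dvd_sum fun j _ => (hE n j i hi).mul_right _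
  -- For `n ≥ |y 0|` this number lies between `1` and `2n + 1`, hence below `q n i`.
  have h3 : (q n i : ℤ) ∣ y 0 + (n + 1) :=
    (dvd_sub_right (h2.mul_left _)).1 (h1.trans (hUc f y h n))
  have h4 := Int.le_of_dvd (by omega) h3
  have h5 := hlarge n i
  omega

end WhiteheadUniformization

/-! ### Decoding the colors. -/

namespace WhiteheadUniformization

/-- The values `F₀`, `F₁`, known modulo a large prime `q` up to a common unknown factor `P` and small
errors `k₀`, `k₁`, determine whether `c = 1` or `c = 0`. -/
theorem exists_dvd_iff_of_dvd {q j P F₀ F₁ k₀ k₁ c : ℤ} (hq : Prime q) (hj : 0 < j)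
    (hjq : 30 * j ^ 2 < q) (hk₀ : |k₀| ≤ j) (hk₁ : |k₁| ≤ j) (hc : c = 0 ∨ c = 1)
    (h₀ : q ∣ P * F₀ - (k₀ + c * (4 * j))) (h₁ : q ∣ P * F₁ - (k₁ + 4 * j)) :
    (∃ l₀ l₁ : ℤ, |l₀| ≤ j ∧ |l₁| ≤ j ∧ q ∣ F₀ * (l₁ + 4 * j) - F₁ * (l₀ + 4 * j)) ↔ c = 1 := by
  rw [abs_le] at hk₀ hk₁
  constructor
  · rintro ⟨l₀, l₁, hl₀, hl₁, hl⟩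
    refine hc.resolve_left fun hc0 => ?_
    subst hc0
    rw [abs_le] at hl₀ hl₁
    -- If `c = 0`, the first product is in `[9j², 25j²]` and the second at most `5j²` in size, so
    -- the difference is in `[4j², 30j²]`, contradicting `30j² < q`.
    have h : q ∣ (k₁ + 4 * j) * (l₀ + 4 * j) - k₀ * (l₁ + 4 * j) := by
      obtain ⟨a, ha⟩ := h₀
      obtain ⟨b, hb⟩ := h₁
      obtain ⟨d, hd⟩ := hl
      exact ⟨a * (l₁ + 4 * j) - b * (l₀ + 4 * j) - P * d,
        by linear_combination (l₁ + 4 * j) * ha - (l₀ + 4 * j) * hb - P * hd⟩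
    have h1 : (3 * j) * (3 * j) ≤ (k₁ + 4 * j) * (l₀ + 4 * j) :=
      mul_le_mul (by linarith) (by linarith) (by linarith) (by linarith)
    have h2 : (k₁ + 4 * j) * (l₀ + 4 * j) ≤ (5 * j) * (5 * j) :=
      mul_le_mul (by linarith) (by linarith) (by linarith) (by linarith)
    have h3 : |k₀ * (l₁ + 4 * j)| ≤ j * (5 * j) := by
      rw [abs_mul]
      exact mul_le_mul (abs_le.2 hk₀) (abs_le.2 ⟨by linarith, by linarith⟩) (abs_nonneg _) hj.le
    rw [abs_le] at h3
    have hjj : 0 < j ^ 2 := by positivity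
    have := Int.le_of_dvd (by nlinarith) h
    nlinarith
  · rintro rfl
    refine ⟨k₀, k₁, abs_le.2 hk₀, abs_le.2 hk₁, ?_⟩
    -- Otherwise `q` divides `k₁ + 4j`, which lies in `[3j, 5j]`.
    have hP : ¬ q ∣ P := fun hP => by
      have := Int.le_of_dvd (by linarith) ((dvd_sub_right (hP.mul_right F₁)).1 h₁)
      nlinarith
    refine (hq.dvd_or_dvd ?_).resolve_left hP
    obtain ⟨a, ha⟩ := h₀
    obtain ⟨b, hb⟩ := h₁
    exact ⟨a * (k₁ + 4 * j) - b * (k₀ + 4 * j),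
      by linear_combination (k₁ + 4 * j) * ha - (k₀ + 4 * j) * hb⟩

variable {S : Set OmegaOne}

/-- The ladder system obtained by deleting the first `N δ` elements of the ladder of `δ`. -/
def LadderSystem.shift (η : LadderSystem S) (N : S → ℕ) : LadderSystem S where
  ladder δ n := η.ladder δ (n + N δ)
  strictMono δ _ _ h := η.strictMono δ (Nat.add_lt_add_right h _)
  lt δ n := η.lt δ _
  cofinal δ γ hγ := by
    obtain ⟨n, hn⟩ := η.cofinal δ γ hγ
    exact ⟨n, hn.trans ((η.strictMono δ).monotone (Nat.le_add_right _ _))⟩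

theorem LadderSystem.Uniformization.of_shift {K : Type} {η : LadderSystem S} {N : S → ℕ}
    (h : (η.shift N).Uniformization K) : η.Uniformization K := by
  rw [uniformization_iff_eventually] at h ⊢
  intro c
  obtain ⟨f, hf⟩ := h fun δ n => c δ (n + N δ)
  exact ⟨f, fun δ => (Filter.map_add_atTop_eq_nat (N δ)).symm ▸ Filter.eventually_map.2 (hf δ)⟩

namespace AllWhitehead

/-- Every ladder system has tails on which a single integer-valued function is injective. -/
theorem exists_injective (h : AllWhitehead S) (hS : S ⊆ limOmegaOne) (η : LadderSystem S) :
    ∃ (N : S → ℕ) (f : OmegaOne → ℤ),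
      ∀ δ, Function.Injective fun n => f ((η.shift N).ladder δ n) := by
  obtain ⟨M, U, c, hM, hinj⟩ := exists_coefficients_of_injective
  obtain ⟨f, y, hfy⟩ := h.exists_solution hS η (M := fun _ => M) (fun _ => hM) (fun _ => U) fun _ => c
  choose N hN using fun δ => hinj (fun n => f (η.ladder δ n)) (y δ) (hfy δ)
  refine ⟨N, f, fun δ => Function.Injective.of_lt_imp_ne fun m n hmn heq => ?_⟩
  exact hN δ (n + N δ) (Nat.le_add_left _ _) (m + N δ) (Nat.add_lt_add_right hmn _) heq.symm

/-- Congruences modulo primes attached injectively to the members of the ladders are solvable, up to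
an integer and a factor depending only on the ladder. -/
theorem exists_congruences (h : AllWhitehead S) (hS : S ⊆ limOmegaOne) (η : LadderSystem S)
    {q : OmegaOne → ℕ} (hq : ∀ α, (q α).Prime)
    (hinj : ∀ δ, Function.Injective fun n => q (η.ladder δ n)) (Γ : S → ℕ → ℤ) :
    ∃ (f : OmegaOne → ℤ) (z : S → ℤ), ∀ δ n, (q (η.ladder δ n) : ℤ) ∣
      (∏ i ∈ Finset.range n, (q (η.ladder δ i) : ℤ)) * f (η.ladder δ n) - (z δ + Γ δ n) := by
  choose U c hUc using fun δ => exists_coefficients_of_congruences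
    (fun n => (q (η.ladder δ n) : ℤ)) (fun i j hij => Nat.isCoprime_iff_coprime.2
      ((Nat.coprime_primes (hq _) (hq _)).2 ((hinj δ).ne hij))) 0 (Γ δ)
  obtain ⟨f, y, hfy⟩ := h.exists_solution hS η (M := fun δ n => q (η.ladder δ n))
    (fun δ n => Int.natCast_ne_zero.2 (hq _).ne_zero) U c
  refine ⟨f, fun δ => y δ 0, fun δ n => ?_⟩
  simpa using hUc δ (fun n => f (η.ladder δ n)) (y δ) (hfy δ) n

theorem uniformization_fin_two (h : AllWhitehead S) (hS : S ⊆ limOmegaOne) (η : LadderSystem S) :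
    η.Uniformization (Fin 2) := by
  classical
  obtain ⟨N, e, he⟩ := h.exists_injective hS η
  refine LadderSystem.Uniformization.of_shift (N := N) ?_
  generalize η.shift N = η at he
  rw [LadderSystem.uniformization_iff_eventually]
  intro c
  -- Both `j` and the prime `q` depend on `α` alone, so the decoding does not need `δ` or `n`.
  -- Injectivity along a ladder makes `j` tend to infinity, and it eventually exceeds the unknowns
  -- `z₀ δ`, `z₁ δ`, which play the part of the small errors.
  let j : OmegaOne → ℕ := fun α => Encodable.encode (e α)
  let q : OmegaOne → ℕ := fun α => Nat.nth Nat.Prime (30 * j α ^ 2)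
  have hj : ∀ δ, Function.Injective fun n => j (η.ladder δ n) := fun δ =>
    Encodable.encode_injective.comp (he δ)
  have hq : ∀ α, (q α).Prime := fun α => Nat.prime_nth_prime _
  have hjq : ∀ α, 30 * j α ^ 2 < q α := fun α =>
    (Nat.lt_add_of_pos_right two_pos).trans_le (Nat.add_two_le_nth_prime _)
  have hqinj : ∀ δ, Function.Injective fun n => q (η.ladder δ n) := fun δ m n hmn => hj δ <| by
    have := Nat.nth_injective Nat.infinite_setOfPred_prime hmn
    exact Nat.pow_left_injective two_ne_zero (Nat.eq_of_mul_eq_mul_left (by norm_num) this)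
  obtain ⟨f₁, z₁, h₁⟩ := h.exists_congruences hS η hq hqinj fun δ n => 4 * j (η.ladder δ n)
  obtain ⟨f₀, z₀, h₀⟩ := h.exists_congruences hS η hq hqinj
    fun δ n => (c δ n : ℕ) * (4 * j (η.ladder δ n))
  refine ⟨fun α => if ∃ l₀ l₁ : ℤ, |l₀| ≤ j α ∧ |l₁| ≤ j α ∧
    (q α : ℤ) ∣ f₀ α * (l₁ + 4 * j α) - f₁ α * (l₀ + 4 * j α) then 1 else 0, fun δ => ?_⟩
  filter_upwards [(hj δ).nat_tendsto_atTop.eventually_ge_atTop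
    (max 1 (max (z₀ δ).natAbs (z₁ δ).natAbs))] with n hn
  simp only [max_le_iff] at hn
  have hc : ((c δ n : ℕ) : ℤ) = 0 ∨ ((c δ n : ℕ) : ℤ) = 1 := by omega
  have key := exists_dvd_iff_of_dvd (Nat.prime_iff_prime_int.1 (hq _)) (by omega)
    (by exact_mod_cast hjq (η.ladder δ n)) (abs_le.2 (by omega)) (abs_le.2 (by omega)) hc
    (h₀ δ n) (h₁ δ n)
  rw [if_congr key rfl rfl]
  split_ifs with h1 <;> ext <;> simp <;> omega

end AllWhitehead

end WhiteheadUniformization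

theorem theorem3p2 (S : Set WhiteheadUniformization.OmegaOne)
    (hlim : S ⊆ WhiteheadUniformization.limOmegaOne) (hS : IsStationary S) :
    -- (1) implies (2)
    (WhiteheadUniformization.AllCoseparable S → WhiteheadUniformization.AllWhitehead S) ∧
    -- (2) implies (3)
    (WhiteheadUniformization.AllWhitehead S →
      ∀ η : WhiteheadUniformization.LadderSystem S, η.Uniformization (Fin 2)) ∧
    -- (3) iff (4)
    ((∀ η : WhiteheadUniformization.LadderSystem S, η.Uniformization (Fin 2)) ↔
      ∀ η : WhiteheadUniformization.LadderSystem S, η.Uniformization ℕ) ∧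
    -- (4) iff (5)
    ((∀ η : WhiteheadUniformization.LadderSystem S, η.Uniformization ℕ) ↔
      ∀ η : WhiteheadUniformization.LadderSystem S, η.UniformizationOnClub (Fin 2)) ∧
    -- (5) iff (6)
    ((∀ η : WhiteheadUniformization.LadderSystem S, η.UniformizationOnClub (Fin 2)) ↔
      ∀ η : WhiteheadUniformization.LadderSystem S, η.UniformizationOnClub ℕ) := by
  have h35 (h : ∀ η : WhiteheadUniformization.LadderSystem S, η.Uniformization (Fin 2))
      (η : WhiteheadUniformization.LadderSystem S) : η.UniformizationOnClub (Fin 2) := (h η).onClub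
  have h56 := WhiteheadUniformization.uniformizationOnClub_nat_of_fin_two hlim
  have h64 := WhiteheadUniformization.uniformization_of_uniformizationOnClub hlim
  have h43 (h : ∀ η : WhiteheadUniformization.LadderSystem S, η.Uniformization ℕ)
      (η : WhiteheadUniformization.LadderSystem S) : η.Uniformization (Fin 2) := (h η).fin_two
  exact ⟨fun h A _ hA hfree hΓ => .of_isAlephOneCoseparable (h A hA hfree hΓ),
    fun h => h.uniformization_fin_two hlim,
    ⟨fun h => h64 (h56 (h35 h)), h43⟩, ⟨fun h => h35 (h43 h), fun h => h64 (h56 h)⟩,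
    ⟨h56, fun h => h35 (h43 (h64 h))⟩⟩
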